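/- Let $d\ge 0$, $M,T\ge 1$ be integers. Let $\nu$ be a law on $\mathbb R$ with $\mathbb E u=0$, $\mathbb E u^2=1$, $\mathbb E u^3=0$, $k_\varphi:=\mathbb E u^4<\infty$ that has a Lebesgue density with finite differential entropy, and let $\varphi=\nu^{\otimes d}$ (i.i.d. components). Let the diagonal conditioner $\phi:\mathbb R\to(0,\infty)$ be twice differentiable, 1-Lipschitz, and such that $\log\phi$ is $L_\phi$-smooth, $L_\phi\ge 0$. (Here $f$ is $L$-smooth if it is differentiable with $L$-Lipschitz gradient.) The variational parameters are $\lambda=(m,s)\in\Lambda=\mathbb R^d\times\mathbb R^d$ with $C(\lambda)=\operatorname{diag}(\phi(s_1),\dots,\phi(s_d))$ (mean-field), or $\lambda=(m,s,L)$ with $L$ strictly lower triangular and $C(\lambda)=\operatorname{diag}(\phi(s_1),\dots,\phi(s_d))+L$ (Cholesky), with the Euclidean norm on $\Lambda$. Put $\mathcal T_\lambda(u)=C(\lambda)u+m$ and let $q_\lambda$ be the law of $\mathcal T_\lambda(u)$, $u\sim\varphi$. Let $p(x\mid z)>0$ be the likelihood of the fixed data $x$ and $p(z)>0$ a prior probability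 density on $\mathbb R^d$; put $\ell_{\rm like}(z)=-\log p(x\mid z)$, $\ell(z)=-\log\big(p(x\mid z)p(z)\big)$, $h(\lambda)=-\mathbb H(q_\lambda)$ (negative differential entropy) and let $$F(\lambda)=\mathbb E_{z\sim q_\lambda}\ell(z)+h(\lambda)$$ be the negative ELBO. Assume that * $\ell$ is $L_\ell$-smooth, $L_\ell>0$; * for some $L_s\ge 0$, $\big|\mathbb E_{u\sim\varphi}\,[\partial_i\ell(\mathcal T_\lambda(u))\,u_i\,\phi''(s_i)]\big|\le L_s$ for all $i$ and all $\lambda\in\Lambda$; * $\ell_{\rm like}$ has a unique minimizer $\bar z_{\rm like}$ and is $\mu$-quadratically growing, $\mu>0$: $\frac\mu2\|z-\bar z_{\rm like}\|_2^2\le\ell_{\rm like}(z)-\ell^*_{\rm like}$ for all $z$, where $\ell^*_{\rm like}=\inf_z\ell_{\rm like}(z)$. Let $\bar z_{\rm joint}$ be any minimizer of $\ell$, and put $L_F=L_\ell+L_\phi+L_s$, $\kappa=L_\ell/\mu$, $F^*=\inf_{\lambda\in\Lambda}F(\lambda)$, and $C(d,\varphi)=d+k_\varphi$ for the Cholesky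 family, $C(d,\varphi)=2k_\varphi\sqrt d+1$ for the mean-field family. Let $0<\gamma<1/L_F$, let $\lambda_0\in\Lambda$, and let $$\lambda_{t+1}=\lambda_t-\gamma\Big(\frac1M\sum_{m=1}^M\nabla_\lambda\,\ell(\mathcal T_\lambda(u_{t,m}))\big|_{\lambda=\lambda_t}+\nabla h(\lambda_t)\Big),\qquad u_{t,m}\ \text{i.i.d.}\sim\varphi,$$ be the iterates of black-box variational inference with SGD and the $M$-sample reparameterization gradient. Then $F$ is differentiable and bounded below, $\mathbb E\|\nabla F(\lambda_t)\|_2^2<\infty$ for all $t$, and $$\min_{0\le t\le T-1}\mathbb E\|\nabla F(\lambda_t)\|_2^2\le\gamma\,\frac{2L_FL_\ell\kappa\,C(d,\varphi)}{M}\Big(\|\bar z_{\rm joint}-\bar z_{\rm like}\|_2^2+2(F^*-\ell^*_{\rm like})\Big)+\frac{2}{\gamma T}\Big(1+\gamma^2\frac{4L_FL_\ell\kappa\,C(d,\varphi)}{M}\Big)^T\big(F(\lambda_0)-F^*\big).$$ -/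

import Mathlib

open MeasureTheory ProbabilityTheory

noncomputable section

namespace BBVI

/-- The two nonlinear scale parameterizations: mean-field (diagonal scale) and full-rank Cholesky
(lower triangular scale). -/
inductive ScaleFamily where
  | meanField
  | cholesky
  deriving DecidableEq

/-- Positions of the free off-diagonal entries of the scale matrix: the strictly lower triangular
ones for the Cholesky family, none for the mean-field family. -/
abbrev OffDiag (fam : ScaleFamily) (d : ℕ) : Type :=
  {p : Fin d × Fin d // fam = ScaleFamily.cholesky ∧ p.2 < p.1}

/-- The space `Λ` of variational parameters `(m, s)` (mean-field) or `(m, s, L)` (Cholesky), with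
the Euclidean norm. The diagonal parameter `s` ranges over all of `ℝ^d`. -/
abbrev Param (fam : ScaleFamily) (d : ℕ) : Type :=
  EuclideanSpace ℝ (Fin d ⊕ (Fin d ⊕ OffDiag fam d))

variable {fam : ScaleFamily} {d : ℕ}

/-- The location `m`. -/
def loc (lam : Param fam d) : EuclideanSpace ℝ (Fin d) :=
  WithLp.toLp 2 fun i => lam (Sum.inl i)

/-- The unconstrained parameter `s_i` of the `i`-th diagonal entry of the scale. -/
def diagParam (lam : Param fam d) (i : Fin d) : ℝ :=
  lam (Sum.inr (Sum.inl i))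

/-- The scale matrix `C(λ) = D_φ(s)` (mean-field) or `C(λ) = D_φ(s) + L` (Cholesky), where `φ` is
the diagonal conditioner. -/
def scale (φ : ℝ → ℝ) (lam : Param fam d) : Matrix (Fin d) (Fin d) ℝ :=
  Matrix.of fun i j =>
    if i = j then φ (diagParam lam i)
    else if h : fam = ScaleFamily.cholesky ∧ j < i then lam (Sum.inr (Sum.inr ⟨(i, j), h⟩))
    else 0

/-- The location-scale reparameterization function `T_λ(u) = C(λ) u + m`. -/
def reparam (φ : ℝ → ℝ) (lam : Param fam d) (u : Fin d → ℝ) : EuclideanSpace ℝ (Fin d) :=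
  WithLp.toLp 2 ((scale φ lam).mulVec u) + loc lam

/-- The base distribution on `ℝ^d` with i.i.d. components of law `ν`. -/
def base (d : ℕ) (ν : Measure ℝ) : Measure (Fin d → ℝ) :=
  Measure.pi fun _ => ν

/-- Fourth moment of a component of the base distribution. -/
def kurtosis (ν : Measure ℝ) : ℝ := ∫ x, x ^ 4 ∂ν

/-- Differential entropy (with respect to Lebesgue measure) of a measure having a density. -/
def diffEntropy {E : Type*} [MeasureSpace E] (ρ : Measure E) : ℝ :=
  -∫ z, Real.log ((ρ.rnDeriv volume z).toReal) ∂ρ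

/-- Law of one component of the base distribution: standardized, with vanishing third and finite
fourth moment, and with a Lebesgue density of finite differential entropy. -/
structure IsBaseLaw (ν : Measure ℝ) : Prop where
  isProb : IsProbabilityMeasure ν
  integrable_pow_four : Integrable (fun x : ℝ => x ^ 4) ν
  mean : ∫ x, x ∂ν = 0
  second : ∫ x, x ^ 2 ∂ν = 1
  third : ∫ x, x ^ 3 ∂ν = 0
  absCont : ν ≪ volume
  integrable_log_density : Integrable (fun x => Real.log ((ν.rnDeriv volume x).toReal)) ν

/-- The variational distribution `q_λ`: the law of `T_λ(u)` for `u` drawn from the base. -/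
def varDist (ν : Measure ℝ) (φ : ℝ → ℝ) (lam : Param fam d) :
    Measure (EuclideanSpace ℝ (Fin d)) :=
  (base d ν).map (reparam φ lam)

/-- `ℓ_like(z) = -log p(x | z)`, for the likelihood `lik z = p(x | z)` of the fixed data `x`. -/
def negLogLik (lik : EuclideanSpace ℝ (Fin d) → ℝ) (z : EuclideanSpace ℝ (Fin d)) : ℝ :=
  -Real.log (lik z)

/-- `ℓ(z) = -log p(z, x) = -log (p(x | z) p(z))`. -/
def negLogJoint (lik prior : EuclideanSpace ℝ (Fin d) → ℝ) (z : EuclideanSpace ℝ (Fin d)) : ℝ :=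
  -Real.log (lik z * prior z)

/-- The energy `f(λ) = E_{z ∼ q_λ} ℓ(z)`. -/
def energy (ν : Measure ℝ) (φ : ℝ → ℝ) (ell : EuclideanSpace ℝ (Fin d) → ℝ)
    (lam : Param fam d) : ℝ :=
  ∫ z, ell z ∂(varDist ν φ lam)

/-- The entropic regularizer `h(λ) = -H(q_λ)`. -/
def negEntropy (ν : Measure ℝ) (φ : ℝ → ℝ) (lam : Param fam d) : ℝ :=
  -diffEntropy (varDist ν φ lam)

/-- The negative ELBO `F(λ) = f(λ) + h(λ)`. -/
def negElbo (ν : Measure ℝ) (φ : ℝ → ℝ) (ell : EuclideanSpace ℝ (Fin d) → ℝ)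
    (lam : Param fam d) : ℝ :=
  energy ν φ ell lam + negEntropy ν φ lam

/-- `L`-smoothness: differentiable with `L`-Lipschitz gradient. -/
def IsSmooth {E : Type*} [NormedAddCommGroup E] [InnerProductSpace ℝ E] [CompleteSpace E]
    (L : ℝ) (f : E → ℝ) : Prop :=
  Differentiable ℝ f ∧ ∀ z w, ‖gradient f z - gradient f w‖ ≤ L * ‖z - w‖

/-- The set of global minimizers. -/
def minimizers {E : Type*} (f : E → ℝ) : Set E := {z | ∀ w, f z ≤ f w}

/-- `p` is a (metric) projection of `z` onto `S`. -/
def IsProj {E : Type*} [NormedAddCommGroup E] (S : Set E) (z p : E) : Prop :=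
  p ∈ S ∧ ∀ q ∈ S, ‖z - p‖ ≤ ‖z - q‖

/-- `μ`-quadratic growth: `μ / 2 * ‖z - z̄‖ ^ 2 ≤ f z - inf f`, with `z̄` the projection of `z` onto
the set of minimizers of `f`. -/
def QuadraticallyGrowing {E : Type*} [NormedAddCommGroup E] (μ : ℝ) (f : E → ℝ) : Prop :=
  (minimizers f).Nonempty ∧
    ∀ z p, IsProj (minimizers f) z p → μ / 2 * ‖z - p‖ ^ 2 ≤ f z - ⨅ w, f w

/-- The diagonal conditioner `φ : ℝ → (0, ∞)`: twice differentiable, `1`-Lipschitz and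
`Lφ`-log-smooth. -/
structure IsConditioner (φ : ℝ → ℝ) (Lφ : ℝ) : Prop where
  pos : ∀ x, 0 < φ x
  differentiable : Differentiable ℝ φ
  differentiable_deriv : Differentiable ℝ (deriv φ)
  lipschitz : LipschitzWith 1 φ
  logSmooth : IsSmooth Lφ fun x => Real.log (φ x)

/-- `|E g_i(λ; u) u_i φ''(s_i)| ≤ Ls` for every coordinate `i` and every `λ`, where
`g(λ; u) = ∇ℓ(T_λ(u))`. -/
def ReparamGradientBound (fam : ScaleFamily) (ν : Measure ℝ) (φ : ℝ → ℝ)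
    (ell : EuclideanSpace ℝ (Fin d) → ℝ) (Ls : ℝ) : Prop :=
  ∀ (lam : Param fam d) (i : Fin d),
    |∫ u, gradient ell (reparam φ lam u) i * u i * deriv (deriv φ) (diagParam lam i) ∂(base d ν)|
      ≤ Ls

/-- The `M`-sample reparameterization gradient estimator
`(1 / M) ∑ₘ ∇_λ ℓ(T_λ(u_m))` of the gradient of the energy. -/
def gradEst {M : ℕ} (φ : ℝ → ℝ) (ell : EuclideanSpace ℝ (Fin d) → ℝ)
    (u : Fin M → Fin d → ℝ) (lam : Param fam d) : Param fam d :=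
  (1 / (M : ℝ)) • ∑ m, gradient (fun lam' : Param fam d => ell (reparam φ lam' (u m))) lam

/-- The iterates of BBVI with SGD and fixed stepsize `γ` started at `lam0`; `u t m` is the `m`-th
base sample used in step `t`. -/
def sgd {M : ℕ} (ν : Measure ℝ) (φ : ℝ → ℝ) (ell : EuclideanSpace ℝ (Fin d) → ℝ) (γ : ℝ)
    (lam0 : Param fam d) (u : ℕ → Fin M → Fin d → ℝ) : ℕ → Param fam d
  | 0 => lam0
  | t + 1 =>
    let lam := sgd ν φ ell γ lam0 u t
    lam - γ • (gradEst φ ell (u t) lam + gradient (negEntropy ν φ) lam)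

/-- The constant `C(d, φ)`: `d + k_φ` for Cholesky and `2 k_φ √d + 1` for mean-field. -/
def dimConst (fam : ScaleFamily) (d : ℕ) (ν : Measure ℝ) : ℝ :=
  match fam with
  | ScaleFamily.cholesky => d + kurtosis ν
  | ScaleFamily.meanField => 2 * kurtosis ν * √(d : ℝ) + 1

end BBVI

end

open BBVI

/-! The conditioner enters only through `condMap`, which replaces each s_i by φ(s_i). In the
conditioned parameter w = `condMap φ lam` the reparameterization is linear, and since the base law
is standardized it is an isometry in mean square (`hasMean_norm_linReparam_sq`). So w ↦ E ℓ(T_w(u))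
inherits the smoothness constant Lℓ of ℓ. Returning to λ costs L_s, because the Jacobian of
`condMap` is diagonal with entries of modulus at most 1 and varies through φ''. The negative entropy
is a constant minus ∑ log φ(s_i) and costs L_φ. Together F satisfies the descent inequality with
constant L_F (`negElbo_le_add`).

The gradient noise must then be controlled by F itself. Write C for the scale matrix and c for the
dimensional constant `dimConst`. (1) `reparamVar_le`: the one-sample variance is at most 2c
(Lℓ²‖C‖_F² + ‖E∇ℓ‖²). (2) `add_norm_centered_sq_le_negElbo`: F is E ℓ_like plus the relative entropy
of q_λ to the prior, so Gibbs' inequality and quadratic growth give (μ/2)‖C‖_F² ≤ F − ℓ_like*. (3)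
`norm_loc_meanGrad_sq_le`: the entropy is translation invariant, so F is Lℓ-smooth along m and
‖E∇ℓ‖² ≤ 2Lℓ(F − F*). When d > 0, κ ≥ 1 (`quadraticGrowth_le_smoothness`), as otherwise the prior
would have infinite mass. Hence the variance is at most an affine function of F − F*.

Inserted into the expected descent of one step, this gives E δ_{t+1} ≤ (1 + a) E δ_t − (γ/2)
E‖∇F(λ_t)‖² + b for δ = F − F*, with a and b proportional to γ². The recursion is telescoped in
`inf'_le_of_descent`. The resulting bound lacks the squared distance between the two minimizers,
which is added at the end as a nonnegative term. -/

namespace BBVI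

open Filter Topology
open scoped RealInnerProductSpace

variable {fam : ScaleFamily} {d : ℕ}

/-! ### Linear algebra of the location-scale reparameterization -/

/-- The location-scale map `v ↦ C(v) u + m(v)` with the identity as conditioner; it is linear in the
parameter. -/
noncomputable def linReparam (u : Fin d → ℝ) : Param fam d →L[ℝ] EuclideanSpace ℝ (Fin d) :=
  LinearMap.toContinuousLinearMap
    { toFun := fun v => WithLp.toLp 2 fun i => v (Sum.inl i) + v (Sum.inr (Sum.inl i)) * u i
        + ∑ p : OffDiag fam d, if p.1.1 = i then v (Sum.inr (Sum.inr p)) * u p.1.2 else 0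
      map_add' := by
        intro v w
        ext i
        simp only [PiLp.add_apply, add_mul, ite_add_zero, Finset.sum_add_distrib]
        ring
      map_smul' := by
        intro c v
        ext i
        simp only [PiLp.smul_apply, smul_eq_mul, RingHom.id_apply, mul_add, Finset.mul_sum,
          mul_ite, mul_zero, mul_assoc] }

theorem linReparam_apply (u : Fin d → ℝ) (v : Param fam d) (i : Fin d) :
    linReparam u v i = v (Sum.inl i) + v (Sum.inr (Sum.inl i)) * u i
        + ∑ p : OffDiag fam d, if p.1.1 = i then v (Sum.inr (Sum.inr p)) * u p.1.2 else 0 := rfl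

/-- The adjoint of `linReparam u`. -/
noncomputable def adjReparam (u : Fin d → ℝ) (g : EuclideanSpace ℝ (Fin d)) : Param fam d :=
  WithLp.toLp 2 fun
    | Sum.inl i => g i
    | Sum.inr (Sum.inl i) => u i * g i
    | Sum.inr (Sum.inr p) => u p.1.2 * g p.1.1

@[simp] theorem adjReparam_inl (u : Fin d → ℝ) (g : EuclideanSpace ℝ (Fin d)) (i : Fin d) :
    (adjReparam u g : Param fam d) (Sum.inl i) = g i := rfl

@[simp] theorem adjReparam_inr_inl (u : Fin d → ℝ) (g : EuclideanSpace ℝ (Fin d)) (i : Fin d) :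
    (adjReparam u g : Param fam d) (Sum.inr (Sum.inl i)) = u i * g i := rfl

@[simp] theorem adjReparam_inr_inr (u : Fin d → ℝ) (g : EuclideanSpace ℝ (Fin d))
    (p : OffDiag fam d) :
    (adjReparam u g : Param fam d) (Sum.inr (Sum.inr p)) = u p.1.2 * g p.1.1 := rfl

theorem param_inner (v w : Param fam d) :
    ⟪v, w⟫ = ∑ i, v (Sum.inl i) * w (Sum.inl i)
      + (∑ i, v (Sum.inr (Sum.inl i)) * w (Sum.inr (Sum.inl i))
      + ∑ p, v (Sum.inr (Sum.inr p)) * w (Sum.inr (Sum.inr p))) := by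
  simp only [PiLp.inner_apply, Fintype.sum_sum_type, RCLike.inner_apply, conj_trivial]
  simp only [mul_comm]

theorem param_norm_sq (v : Param fam d) :
    ‖v‖ ^ 2 = ∑ i, v (Sum.inl i) ^ 2
      + (∑ i, v (Sum.inr (Sum.inl i)) ^ 2 + ∑ p, v (Sum.inr (Sum.inr p)) ^ 2) := by
  rw [← real_inner_self_eq_norm_sq, param_inner]
  simp only [sq]

theorem sum_diag_sq_le (v : Param fam d) : ∑ i, v (Sum.inr (Sum.inl i)) ^ 2 ≤ ‖v‖ ^ 2 := by
  rw [param_norm_sq]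
  have : 0 ≤ ∑ i, v (Sum.inl i) ^ 2 := Finset.sum_nonneg fun _ _ => sq_nonneg _
  have : 0 ≤ ∑ p, v (Sum.inr (Sum.inr p)) ^ 2 := Finset.sum_nonneg fun _ _ => sq_nonneg _
  linarith

theorem inner_linReparam (u : Fin d → ℝ) (v : Param fam d) (g : EuclideanSpace ℝ (Fin d)) :
    ⟪linReparam u v, g⟫ = ⟪v, adjReparam u g⟫ := by
  rw [param_inner]
  simp only [PiLp.inner_apply, RCLike.inner_apply, conj_trivial, linReparam_apply,
    adjReparam_inl, adjReparam_inr_inl, adjReparam_inr_inr, mul_add, Finset.sum_add_distrib]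
  rw [← add_assoc]
  congr 1
  · congr 1
    · exact Finset.sum_congr rfl fun i _ => by ring
    · exact Finset.sum_congr rfl fun i _ => by ring
  · simp only [Finset.mul_sum]
    rw [Finset.sum_comm]
    refine Finset.sum_congr rfl fun p _ => ?_
    rw [Finset.sum_eq_single p.1.1]
    · simp; ring
    · intro b _ hb
      simp [Ne.symm hb]
    · simp

/-- Padding by zero turns sums over the free entries into sums over all matrix positions, so both
families are treated at once. -/
theorem sum_offDiag (F : OffDiag fam d → ℝ) :
    (∑ i, ∑ j, if h : fam = ScaleFamily.cholesky ∧ j < i then F ⟨(i, j), h⟩ else 0)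
      = ∑ p, F p := by
  rw [← Fintype.sum_prod_type'
    (f := fun i j => if h : fam = ScaleFamily.cholesky ∧ j < i then F ⟨(i, j), h⟩ else 0)]
  symm
  refine Finset.sum_of_injOn (fun p => p.1) Subtype.val_injective.injOn (by simp) ?_ ?_
  · intro q _ hq
    rw [dif_neg]
    intro h
    exact hq ⟨⟨q, h⟩, by simp, rfl⟩
  · intro p _
    rw [dif_pos p.2]

theorem scale_apply_eq_add (φ : ℝ → ℝ) (v : Param fam d) (i j : Fin d) :
    scale φ v i j = (if i = j then φ (diagParam v i) else 0)
      + if h : fam = ScaleFamily.cholesky ∧ j < i then v (Sum.inr (Sum.inr ⟨(i, j), h⟩)) else 0 := by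
  simp only [scale, Matrix.of_apply]
  by_cases hij : i = j
  · subst hij
    simp
  · simp [hij]

theorem linReparam_eq_scale (u : Fin d → ℝ) (v : Param fam d) (i : Fin d) :
    linReparam u v i = v (Sum.inl i) + ∑ j, scale id v i j * u j := by
  rw [linReparam_apply, add_assoc]
  congr 1
  simp only [scale_apply_eq_add, add_mul, Finset.sum_add_distrib, ite_mul, zero_mul,
    Finset.sum_ite_eq, Finset.mem_univ, if_true]
  congr 1
  rw [← sum_offDiag]
  rw [Finset.sum_eq_single i]
  · refine Finset.sum_congr rfl fun j _ => ?_
    by_cases h : fam = ScaleFamily.cholesky ∧ j < i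
    · simp [h]
    · simp [h]
  · intro b _ hb
    refine Finset.sum_eq_zero fun j _ => ?_
    split_ifs <;> simp_all
  · simp

/-- Each matrix entry holds at most one parameter, so no cross terms arise: the scale coordinates
carry exactly the squared Frobenius norm. -/
theorem sum_scale_sq (v : Param fam d) :
    ∑ i, ∑ j, scale id v i j ^ 2
      = ∑ i, v (Sum.inr (Sum.inl i)) ^ 2 + ∑ p, v (Sum.inr (Sum.inr p)) ^ 2 := by
  rw [← sum_offDiag, ← Finset.sum_add_distrib]
  refine Finset.sum_congr rfl fun i _ => ?_
  have : ∀ j, scale id v i j ^ 2 = (if i = j then v (Sum.inr (Sum.inl i)) ^ 2 else 0)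
      + if h : fam = ScaleFamily.cholesky ∧ j < i
        then v (Sum.inr (Sum.inr ⟨(i, j), h⟩)) ^ 2 else 0 := by
    intro j
    rw [scale_apply_eq_add]
    by_cases hij : i = j
    · subst hij
      simp [diagParam]
    · simp only [hij, if_false, zero_add]
      split_ifs <;> simp
  simp only [this, Finset.sum_add_distrib, Finset.sum_ite_eq, Finset.mem_univ, if_true]

/-- The parameter with its diagonal entries passed through the conditioner. -/
noncomputable def condMap (φ : ℝ → ℝ) (lam : Param fam d) : Param fam d :=
  WithLp.toLp 2 fun
    | Sum.inl i => lam (Sum.inl i)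
    | Sum.inr (Sum.inl i) => φ (lam (Sum.inr (Sum.inl i)))
    | Sum.inr (Sum.inr p) => lam (Sum.inr (Sum.inr p))

@[simp] theorem condMap_inl (φ : ℝ → ℝ) (lam : Param fam d) (i : Fin d) :
    condMap φ lam (Sum.inl i) = lam (Sum.inl i) := rfl

@[simp] theorem condMap_inr_inl (φ : ℝ → ℝ) (lam : Param fam d) (i : Fin d) :
    condMap φ lam (Sum.inr (Sum.inl i)) = φ (lam (Sum.inr (Sum.inl i))) := rfl

@[simp] theorem condMap_inr_inr (φ : ℝ → ℝ) (lam : Param fam d) (p : OffDiag fam d) :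
    condMap φ lam (Sum.inr (Sum.inr p)) = lam (Sum.inr (Sum.inr p)) := rfl

/-- All nonlinearity sits in `condMap`. Estimates are proved for the linear map first and pulled
back through this factorization. -/
theorem reparam_eq (φ : ℝ → ℝ) (lam : Param fam d) (u : Fin d → ℝ) :
    reparam φ lam u = linReparam u (condMap φ lam) := by
  ext i
  rw [linReparam_eq_scale]
  have : scale φ lam = scale id (condMap φ lam) := by
    ext i j
    simp [scale, diagParam]
  simp only [reparam, loc, PiLp.add_apply, this, Matrix.mulVec, dotProduct]
  simp [add_comm]

/-- Scaling of the diagonal coordinates by the derivative of the conditioner: the (self-adjoint)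
derivative of `condMap φ` at `lam`. -/
noncomputable def condDeriv (φ : ℝ → ℝ) (lam : Param fam d) : Param fam d →L[ℝ] Param fam d :=
  LinearMap.toContinuousLinearMap
    { toFun := fun v => WithLp.toLp 2 fun
        | Sum.inl i => v (Sum.inl i)
        | Sum.inr (Sum.inl i) => deriv φ (lam (Sum.inr (Sum.inl i))) * v (Sum.inr (Sum.inl i))
        | Sum.inr (Sum.inr p) => v (Sum.inr (Sum.inr p))
      map_add' := by
        intro v w
        ext (i | i | p) <;> simp [mul_add]
      map_smul' := by
        intro c v
        ext (i | i | p) <;> simp [mul_left_comm] }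

@[simp] theorem condDeriv_inl (φ : ℝ → ℝ) (lam v : Param fam d) (i : Fin d) :
    condDeriv φ lam v (Sum.inl i) = v (Sum.inl i) := rfl

@[simp] theorem condDeriv_inr_inl (φ : ℝ → ℝ) (lam v : Param fam d) (i : Fin d) :
    condDeriv φ lam v (Sum.inr (Sum.inl i))
      = deriv φ (lam (Sum.inr (Sum.inl i))) * v (Sum.inr (Sum.inl i)) := rfl

@[simp] theorem condDeriv_inr_inr (φ : ℝ → ℝ) (lam v : Param fam d) (p : OffDiag fam d) :
    condDeriv φ lam v (Sum.inr (Sum.inr p)) = v (Sum.inr (Sum.inr p)) := rfl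

theorem inner_condDeriv (φ : ℝ → ℝ) (lam v w : Param fam d) :
    ⟪condDeriv φ lam v, w⟫ = ⟪v, condDeriv φ lam w⟫ := by
  simp only [param_inner, condDeriv_inl, condDeriv_inr_inl, condDeriv_inr_inr]
  congr 2
  exact Finset.sum_congr rfl fun i _ => by ring

theorem IsConditioner.abs_deriv_le {φ : ℝ → ℝ} {Lφ : ℝ} (hφ : IsConditioner φ Lφ) (x : ℝ) :
    |deriv φ x| ≤ 1 := by
  simpa using norm_deriv_le_of_lipschitz (x₀ := x) hφ.lipschitz

theorem IsConditioner.continuous_deriv {φ : ℝ → ℝ} {Lφ : ℝ} (hφ : IsConditioner φ Lφ) :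
    Continuous (deriv φ) := hφ.differentiable_deriv.continuous

theorem norm_condDeriv_le {φ : ℝ → ℝ} {Lφ : ℝ} (hφ : IsConditioner φ Lφ) (lam v : Param fam d) :
    ‖condDeriv φ lam v‖ ≤ ‖v‖ := by
  refine le_of_sq_le_sq ?_ (norm_nonneg _)
  simp only [param_norm_sq, condDeriv_inl, condDeriv_inr_inl, condDeriv_inr_inr]
  refine add_le_add le_rfl (add_le_add (Finset.sum_le_sum fun i _ => ?_) le_rfl)
  rw [mul_pow]
  have h := hφ.abs_deriv_le (lam (Sum.inr (Sum.inl i)))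
  have : deriv φ (lam (Sum.inr (Sum.inl i))) ^ 2 ≤ 1 := by
    rwa [sq_le_one_iff_abs_le_one]
  nlinarith [sq_nonneg (v (Sum.inr (Sum.inl i)))]

theorem norm_condMap_sub_le {φ : ℝ → ℝ} {Lφ : ℝ} (hφ : IsConditioner φ Lφ)
    (lam lam' : Param fam d) : ‖condMap φ lam - condMap φ lam'‖ ≤ ‖lam - lam'‖ := by
  refine le_of_sq_le_sq ?_ (norm_nonneg _)
  simp only [param_norm_sq, PiLp.sub_apply, condMap_inl, condMap_inr_inl, condMap_inr_inr]
  refine add_le_add le_rfl (add_le_add (Finset.sum_le_sum fun i _ => ?_) le_rfl)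
  have h := hφ.lipschitz.dist_le_mul (lam (Sum.inr (Sum.inl i))) (lam' (Sum.inr (Sum.inl i)))
  rw [Real.dist_eq, Real.dist_eq, NNReal.coe_one, one_mul] at h
  exact sq_le_sq.2 h

theorem hasFDerivAt_condMap {φ : ℝ → ℝ} (hφ : Differentiable ℝ φ) (lam : Param fam d) :
    HasFDerivAt (condMap φ) (condDeriv φ lam) lam := by
  rw [← hasFDerivWithinAt_univ, hasFDerivWithinAt_euclidean]
  simp only [hasFDerivWithinAt_univ]
  have hp : ∀ c, HasFDerivAt (fun l : Param fam d => l c)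
      (EuclideanSpace.proj c : Param fam d →L[ℝ] ℝ) lam := fun c =>
    (EuclideanSpace.proj c : Param fam d →L[ℝ] ℝ).hasFDerivAt
  rintro (i | i | p)
  · exact hp _
  · have := (hφ (lam (Sum.inr (Sum.inl i)))).hasDerivAt.comp_hasFDerivAt lam (hp _)
    refine this.congr_fderiv ?_
    ext v
    simp
  · exact hp _

theorem continuous_condMap {φ : ℝ → ℝ} (hφ : Continuous φ) :
    Continuous (condMap φ : Param fam d → Param fam d) := by
  refine (PiLp.continuous_toLp 2 _).comp (continuous_pi ?_)
  rintro (i | i | p) <;> simp only <;> fun_prop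

theorem continuous_condDeriv_apply {φ : ℝ → ℝ} (hφ : Continuous (deriv φ)) :
    Continuous fun q : Param fam d × Param fam d => condDeriv φ q.1 q.2 := by
  have : Continuous fun (q : Param fam d × Param fam d) c => condDeriv φ q.1 q.2 c := by
    refine continuous_pi ?_
    rintro (i | i | p) <;> simp only [condDeriv_inl, condDeriv_inr_inl, condDeriv_inr_inr] <;>
      fun_prop
  exact (PiLp.continuous_toLp 2 _).comp this

theorem continuous_linReparam_apply :
    Continuous fun q : (Fin d → ℝ) × Param fam d => linReparam q.1 q.2 := by
  have : Continuous fun (q : (Fin d → ℝ) × Param fam d) i => linReparam q.1 q.2 i := by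
    refine continuous_pi fun i => ?_
    simp only [linReparam_apply]
    refine Continuous.add (by fun_prop) (continuous_finsetSum _ fun p _ => ?_)
    split_ifs <;> fun_prop
  exact (PiLp.continuous_toLp 2 _).comp this

theorem continuous_adjReparam :
    Continuous fun q : (Fin d → ℝ) × EuclideanSpace ℝ (Fin d) =>
      (adjReparam q.1 q.2 : Param fam d) := by
  refine (PiLp.continuous_toLp 2 _).comp (continuous_pi ?_)
  rintro (i | i | p) <;> simp only <;> fun_prop

theorem adjReparam_norm_sq (u : Fin d → ℝ) (g : EuclideanSpace ℝ (Fin d)) :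
    ‖(adjReparam u g : Param fam d)‖ ^ 2
      = ‖g‖ ^ 2 + (∑ i, (u i * g i) ^ 2 + ∑ p : OffDiag fam d, (u p.1.2 * g p.1.1) ^ 2) := by
  rw [param_norm_sq]
  simp [EuclideanSpace.real_norm_sq_eq]

/-- Pure translations among the parameters. -/
noncomputable def shift (b : EuclideanSpace ℝ (Fin d)) : Param fam d :=
  WithLp.toLp 2 fun
    | Sum.inl i => b i
    | Sum.inr _ => 0

@[simp] theorem shift_inl (b : EuclideanSpace ℝ (Fin d)) (i : Fin d) :
    (shift b : Param fam d) (Sum.inl i) = b i := rfl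

@[simp] theorem shift_inr (b : EuclideanSpace ℝ (Fin d)) (c) :
    (shift b : Param fam d) (Sum.inr c) = 0 := rfl

@[simp] theorem linReparam_shift (u : Fin d → ℝ) (b : EuclideanSpace ℝ (Fin d)) :
    linReparam u (shift b : Param fam d) = b := by
  ext i
  simp [linReparam_apply]

theorem norm_shift_sq (b : EuclideanSpace ℝ (Fin d)) : ‖(shift b : Param fam d)‖ ^ 2 = ‖b‖ ^ 2 := by
  simp [EuclideanSpace.real_norm_sq_eq]

theorem condMap_add_shift (φ : ℝ → ℝ) (lam : Param fam d) (b : EuclideanSpace ℝ (Fin d)) :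
    condMap φ (lam + shift b) = condMap φ lam + shift b := by
  ext (i | i | p) <;> simp

theorem inner_shift (b : EuclideanSpace ℝ (Fin d)) (v : Param fam d) :
    ⟪v, shift b⟫ = ⟪loc v, b⟫ := by
  simp [loc, PiLp.inner_apply, mul_comm]

/-- The parameter with its location set to zero. -/
noncomputable def centered (v : Param fam d) : Param fam d := v - shift (loc v)

theorem norm_centered_add_shift_sq (v : Param fam d) (b : EuclideanSpace ℝ (Fin d)) :
    ‖centered v + shift b‖ ^ 2 = ‖centered v‖ ^ 2 + ‖b‖ ^ 2 := by
  simp [centered, loc, EuclideanSpace.real_norm_sq_eq]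
  ring

theorem linReparam_centered (u : Fin d → ℝ) (v : Param fam d) :
    linReparam u (centered v) = linReparam u v - loc v := by
  simp [centered]

end BBVI

namespace BBVI

open Filter Topology
open scoped RealInnerProductSpace

variable {fam : ScaleFamily} {d : ℕ}

/-! ### Moments of the base distribution -/

/-- `f` is integrable with mean `c`. -/
def HasMean {α : Type*} [MeasurableSpace α] (ρ : Measure α) (f : α → ℝ) (c : ℝ) : Prop :=
  Integrable f ρ ∧ ∫ x, f x ∂ρ = c

namespace HasMean

variable {α : Type*} [MeasurableSpace α] {ρ : Measure α} {f g : α → ℝ} {a b : ℝ}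

theorem add (hf : HasMean ρ f a) (hg : HasMean ρ g b) : HasMean ρ (fun x => f x + g x) (a + b) :=
  ⟨hf.1.add hg.1, by rw [integral_add hf.1 hg.1, hf.2, hg.2]⟩

theorem sub (hf : HasMean ρ f a) (hg : HasMean ρ g b) : HasMean ρ (fun x => f x - g x) (a - b) :=
  ⟨hf.1.sub hg.1, by rw [integral_sub hf.1 hg.1, hf.2, hg.2]⟩

theorem const_mul (c : ℝ) (hf : HasMean ρ f a) : HasMean ρ (fun x => c * f x) (c * a) :=
  ⟨hf.1.const_mul c, by rw [integral_const_mul, hf.2]⟩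

theorem const [IsProbabilityMeasure ρ] (c : ℝ) : HasMean ρ (fun _ => c) c :=
  ⟨integrable_const c, by simp⟩

theorem sum {ι : Type*} {s : Finset ι} {F : ι → α → ℝ} {m : ι → ℝ}
    (h : ∀ i ∈ s, HasMean ρ (F i) (m i)) : HasMean ρ (fun x => ∑ i ∈ s, F i x) (∑ i ∈ s, m i) :=
  ⟨integrable_finsetSum s fun i hi => (h i hi).1, by
    rw [integral_finsetSum s fun i hi => (h i hi).1]
    exact Finset.sum_congr rfl fun i hi => (h i hi).2⟩

theorem congr (hf : HasMean ρ f a) (hfg : ∀ x, g x = f x) (hab : b = a) : HasMean ρ g b := by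
  rw [hab, funext hfg]
  exact hf

theorem le (hf : HasMean ρ f a) (hg : HasMean ρ g b) (h : ∀ x, f x ≤ g x) : a ≤ b := by
  rw [← hf.2, ← hg.2]
  exact integral_mono hf.1 hg.1 h

end HasMean

theorem _root_.MeasureTheory.Integrable.hasMean {α : Type*} [MeasurableSpace α] {ρ : Measure α}
    {f : α → ℝ} (hf : Integrable f ρ) : HasMean ρ f (∫ x, f x ∂ρ) := ⟨hf, rfl⟩

variable {ν : Measure ℝ}

theorem IsBaseLaw.isProb_base (hν : IsBaseLaw ν) (d : ℕ) : IsProbabilityMeasure (base d ν) := by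
  have := hν.isProb
  unfold base
  infer_instance

theorem IsBaseLaw.integrable_pow (hν : IsBaseLaw ν) {n : ℕ} (hn : n ≤ 4) :
    Integrable (fun x : ℝ => x ^ n) ν := by
  have := hν.isProb
  refine ((integrable_const (1 : ℝ)).add hν.integrable_pow_four).mono'
    (by fun_prop) (Eventually.of_forall fun x => ?_)
  simp only [Pi.add_apply, Real.norm_eq_abs, abs_pow]
  rcases le_total |x| 1 with h | h
  · have h1 : |x| ^ n ≤ 1 := pow_le_one₀ (abs_nonneg _) h
    have h2 : 0 ≤ x ^ 4 := by positivity
    linarith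
  · have h1 : |x| ^ n ≤ |x| ^ 4 := pow_le_pow_right₀ h hn
    have h2 : |x| ^ 4 = x ^ 4 := Even.pow_abs (by decide) x
    linarith

theorem IsBaseLaw.hasMean_monomial (hν : IsBaseLaw ν) (a : Fin d → ℕ) (ha : ∀ i, a i ≤ 4) :
    HasMean (base d ν) (fun u => ∏ i, u i ^ a i) (∏ i, ∫ x, x ^ a i ∂ν) := by
  have := hν.isProb
  exact ⟨Integrable.fintype_prod (f := fun i x => x ^ a i) fun i => hν.integrable_pow (ha i),
    integral_fintype_prod_eq_prod (fun i x => x ^ a i)⟩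

/-- Exponents are sums of indicators, so coincidences among the three indices merge automatically
and one formula serves every mixed moment. -/
theorem IsBaseLaw.hasMean_monomial_three (hν : IsBaseLaw ν) (i j l : Fin d) (p q r : ℕ)
    (h : ∀ m, (if m = i then p else 0) + (if m = j then q else 0) + (if m = l then r else 0) ≤ 4) :
    HasMean (base d ν) (fun u => u i ^ p * u j ^ q * u l ^ r)
      (∏ m, ∫ x, x ^ ((if m = i then p else 0) + (if m = j then q else 0)
        + (if m = l then r else 0)) ∂ν) := by
  refine (hν.hasMean_monomial _ h).congr (fun u => ?_) rfl
  simp only [pow_add, Finset.prod_mul_distrib, pow_ite, pow_zero, Finset.prod_ite_eq',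
    Finset.mem_univ, if_true]

theorem IsBaseLaw.moment_zero (hν : IsBaseLaw ν) : ∫ x, x ^ 0 ∂ν = 1 := by
  have := hν.isProb
  simp

theorem IsBaseLaw.one_le_kurtosis (hν : IsBaseLaw ν) : 1 ≤ kurtosis ν := by
  have := hν.isProb
  have h4 : HasMean ν (fun x => x ^ 4) (kurtosis ν) := hν.integrable_pow_four.hasMean
  have h2 : HasMean ν (fun x => x ^ 2) 1 := ⟨hν.integrable_pow (by norm_num), hν.second⟩
  -- The mean of (x² − 1)² is the kurtosis minus 1.
  have := HasMean.le (HasMean.const 0) ((h4.sub (h2.const_mul 2)).add (HasMean.const 1))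
    fun x => by nlinarith [sq_nonneg (x ^ 2 - 1)]
  linarith

theorem IsBaseLaw.hasMean_eval (hν : IsBaseLaw ν) (i : Fin d) :
    HasMean (base d ν) (fun u => u i) 0 := by
  refine (hν.hasMean_monomial_three i i i 1 0 0 (by intro m; split_ifs <;> simp)).congr
    (fun u => by simp) ?_
  symm
  refine Finset.prod_eq_zero (Finset.mem_univ i) ?_
  simp [hν.mean]

theorem IsBaseLaw.hasMean_mul (hν : IsBaseLaw ν) (i j : Fin d) :
    HasMean (base d ν) (fun u => u i * u j) (if i = j then 1 else 0) := by
  refine (hν.hasMean_monomial_three i j j 1 1 0 (by intro m; split_ifs <;> simp)).congr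
    (fun u => by simp) ?_
  symm
  split_ifs with h
  · subst h
    refine Finset.prod_eq_one fun m _ => ?_
    by_cases hm : m = i
    · simpa [hm] using hν.second
    · simpa [hm] using hν.moment_zero
  · refine Finset.prod_eq_zero (Finset.mem_univ i) ?_
    simp [h, hν.mean]

theorem IsBaseLaw.hasMean_sq_mul_mul (hν : IsBaseLaw ν) (l i j : Fin d) :
    HasMean (base d ν) (fun u => u l ^ 2 * (u i * u j))
      (if i = j then (if l = i then kurtosis ν else 1) else 0) := by
  refine (hν.hasMean_monomial_three l i j 2 1 1 (by intro m; split_ifs <;> simp)).congr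
    (fun u => by simp [mul_assoc]) ?_
  symm
  split_ifs with h hl
  · subst h hl
    rw [Finset.prod_eq_single l]
    · simp [kurtosis]
    · intro m _ hm
      simpa [hm] using hν.moment_zero
    · simp
  · subst h
    refine Finset.prod_eq_one fun m _ => ?_
    by_cases hm : m = i
    · subst hm
      simpa [Ne.symm hl] using hν.second
    · by_cases hml : m = l
      · subst hml
        simpa [hl] using hν.second
      · simpa [hm, hml] using hν.moment_zero
  · refine Finset.prod_eq_zero (Finset.mem_univ i) ?_
    by_cases hil : i = l
    · subst hil
      simpa [h] using hν.third
    · simp [hil, h, hν.mean]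

theorem IsBaseLaw.hasMean_pow_four (hν : IsBaseLaw ν) (i : Fin d) :
    HasMean (base d ν) (fun u => u i ^ 4) (kurtosis ν) :=
  (hν.hasMean_sq_mul_mul i i i).congr (fun u => by ring) (by simp)

theorem IsBaseLaw.hasMean_sq (hν : IsBaseLaw ν) (i : Fin d) :
    HasMean (base d ν) (fun u => u i ^ 2) 1 :=
  (hν.hasMean_mul i i).congr (fun u => by ring) (by simp)

/-- Distinctness lets independence factor a degree-six monomial, so no sixth moment of the base law
is needed. -/
theorem IsBaseLaw.hasMean_pow_four_mul_sq (hν : IsBaseLaw ν) {i j : Fin d} (h : i ≠ j) :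
    HasMean (base d ν) (fun u => u i ^ 4 * u j ^ 2) (kurtosis ν) := by
  refine (hν.hasMean_monomial_three i j j 4 2 0
    (by intro m; split_ifs <;> simp_all)).congr (fun u => by simp) ?_
  symm
  rw [Finset.prod_eq_single i]
  · simp [h, kurtosis]
  · intro m _ hm
    by_cases hj : m = j
    · subst hj
      simpa [hm] using hν.second
    · simpa [hm, hj] using hν.moment_zero
  · simp

theorem IsBaseLaw.hasMean_sq_sub_one_sq (hν : IsBaseLaw ν) (i : Fin d) :
    HasMean (base d ν) (fun u => (u i ^ 2 - 1) ^ 2) (kurtosis ν - 1) := by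
  have := hν.isProb_base d
  exact (((hν.hasMean_pow_four i).sub ((hν.hasMean_sq i).const_mul 2)).add
    (HasMean.const 1)).congr (fun u => by ring) (by ring)

theorem sq_sum_mul (r u : Fin d → ℝ) :
    (∑ j, r j * u j) ^ 2 = ∑ i, ∑ j, r i * r j * (u i * u j) := by
  rw [sq, Finset.sum_mul_sum]
  exact Finset.sum_congr rfl fun i _ => Finset.sum_congr rfl fun j _ => by ring

theorem IsBaseLaw.hasMean_affine_sq (hν : IsBaseLaw ν) (b : ℝ) (r : Fin d → ℝ) :
    HasMean (base d ν) (fun u => (b + ∑ j, r j * u j) ^ 2) (b ^ 2 + ∑ j, r j ^ 2) := by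
  have := hν.isProb_base d
  have h1 : HasMean (base d ν) (fun u => ∑ i, ∑ j, r i * r j * (u i * u j))
      (∑ i, ∑ j, r i * r j * (if i = j then 1 else 0)) :=
    HasMean.sum fun i _ => HasMean.sum fun j _ => (hν.hasMean_mul i j).const_mul _
  have h2 : HasMean (base d ν) (fun u => ∑ j, 2 * b * r j * u j) (∑ j, 2 * b * r j * 0) :=
    HasMean.sum fun i _ => (hν.hasMean_eval i).const_mul _
  refine (((HasMean.const (b ^ 2)).add h2).add h1).congr (fun u => ?_) ?_
  · rw [add_sq, sq_sum_mul r u, Finset.mul_sum]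
    simp only [mul_assoc]
  · simp [sq]

/-- Expanding the square, only diagonal pairs i = j survive; each gets 1 from the d − 1 indices l ≠
i and the kurtosis from l = i. -/
theorem IsBaseLaw.hasMean_normSq_mul_linear_sq (hν : IsBaseLaw ν) (r : Fin d → ℝ) :
    HasMean (base d ν) (fun u => (∑ l, u l ^ 2) * (∑ j, r j * u j) ^ 2)
      ((d + kurtosis ν - 1) * ∑ j, r j ^ 2) := by
  have h1 : HasMean (base d ν)
      (fun u => ∑ l, ∑ i, ∑ j, r i * r j * (u l ^ 2 * (u i * u j)))
      (∑ l, ∑ i, ∑ j, r i * r j * (if i = j then (if l = i then kurtosis ν else 1) else 0)) :=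
    HasMean.sum fun l _ => HasMean.sum fun i _ => HasMean.sum fun j _ =>
      (hν.hasMean_sq_mul_mul l i j).const_mul _
  refine h1.congr (fun u => ?_) ?_
  · rw [sq_sum_mul r u, Finset.sum_mul]
    refine Finset.sum_congr rfl fun l _ => ?_
    simp only [Finset.mul_sum]
    exact Finset.sum_congr rfl fun i _ => Finset.sum_congr rfl fun j _ => by ring
  · simp only [mul_ite, mul_zero, Finset.sum_ite_eq, Finset.mem_univ, if_true, mul_one]
    rw [Finset.sum_comm, Finset.mul_sum]
    refine Finset.sum_congr rfl fun i _ => ?_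
    have : ∀ l : Fin d, (if l = i then r i * r i * kurtosis ν else r i * r i)
        = r i * r i + if l = i then r i * r i * (kurtosis ν - 1) else 0 := by
      intro l
      split_ifs <;> ring
    simp only [this, Finset.sum_add_distrib, Finset.sum_const, Finset.card_univ, Fintype.card_fin,
      Finset.sum_ite_eq', Finset.mem_univ, if_true, nsmul_eq_mul]
    ring

theorem IsBaseLaw.hasMean_normSq (hν : IsBaseLaw ν) :
    HasMean (base d ν) (fun u => ∑ l, u l ^ 2) d :=
  (HasMean.sum fun l _ => hν.hasMean_sq l).congr (fun _ => rfl) (by simp)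

theorem IsBaseLaw.hasMean_normSq_sub_sq (hν : IsBaseLaw ν) :
    HasMean (base d ν) (fun u => (∑ l, u l ^ 2 - d) ^ 2) (d * (kurtosis ν - 1)) := by
  have := hν.isProb_base d
  -- Summing the previous identity over the coordinate vectors yields the mean of the fourth power
  -- of the norm.
  let e : Fin d → Fin d → ℝ := fun i j => if i = j then 1 else 0
  have h1 : HasMean (base d ν) (fun u => ∑ i, (∑ l, u l ^ 2) * (∑ j, e i j * u j) ^ 2)
      (∑ i : Fin d, (d + kurtosis ν - 1) * ∑ j, e i j ^ 2) :=
    HasMean.sum fun i _ => hν.hasMean_normSq_mul_linear_sq (e i)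
  refine ((h1.sub (hν.hasMean_normSq.const_mul (2 * d))).add (HasMean.const (d ^ 2 : ℝ))).congr
    (fun u => ?_) ?_
  · have : ∀ i, ∑ j, e i j * u j = u i := fun i => by simp [e]
    simp only [this, ← Finset.mul_sum]
    ring
  · have : ∀ i, ∑ j, e i j ^ 2 = 1 := fun i => by simp [e]
    simp only [this, Finset.sum_const, Finset.card_univ, Fintype.card_fin, nsmul_eq_mul]
    ring

/-- In expectation, `linReparam` is an isometry. -/
theorem IsBaseLaw.hasMean_norm_linReparam_sq (hν : IsBaseLaw ν) (v : Param fam d) :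
    HasMean (base d ν) (fun u => ‖linReparam u v‖ ^ 2) (‖v‖ ^ 2) := by
  have : HasMean (base d ν) (fun u => ∑ i, (v (Sum.inl i) + ∑ j, scale id v i j * u j) ^ 2)
      (∑ i, (v (Sum.inl i) ^ 2 + ∑ j, scale id v i j ^ 2)) :=
    HasMean.sum fun i _ => hν.hasMean_affine_sq _ _
  refine this.congr (fun u => ?_) ?_
  · rw [EuclideanSpace.real_norm_sq_eq]
    simp only [linReparam_eq_scale]
  · rw [param_norm_sq, Finset.sum_add_distrib, sum_scale_sq]

theorem IsBaseLaw.hasMean_normSq_mul_linReparam_centered (hν : IsBaseLaw ν) (v : Param fam d) :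
    HasMean (base d ν) (fun u => (∑ l, u l ^ 2) * ‖linReparam u (centered v)‖ ^ 2)
      ((d + kurtosis ν - 1) * ‖centered v‖ ^ 2) := by
  have h0 : ∀ i, centered v (Sum.inl i) = 0 := fun i => by simp [centered, loc]
  have : HasMean (base d ν)
      (fun u => ∑ i, (∑ l, u l ^ 2) * (∑ j, scale id (centered v) i j * u j) ^ 2)
      (∑ i, (d + kurtosis ν - 1) * ∑ j, scale id (centered v) i j ^ 2) :=
    HasMean.sum fun i _ => hν.hasMean_normSq_mul_linear_sq _
  refine this.congr (fun u => ?_) ?_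
  · rw [EuclideanSpace.real_norm_sq_eq, ← Finset.mul_sum]
    simp only [linReparam_eq_scale, h0, zero_add]
  · rw [param_norm_sq, ← Finset.mul_sum, sum_scale_sq]
    simp [h0]

end BBVI

namespace BBVI

open Filter Topology
open scoped RealInnerProductSpace

variable {fam : ScaleFamily} {d : ℕ}

/-! ### Smooth functions -/

section Smooth

variable {V : Type*} [NormedAddCommGroup V] [InnerProductSpace ℝ V] [CompleteSpace V]

theorem _root_.HasGradientAt.hasDerivAt_line {f : V → ℝ} {x v g : V} {τ : ℝ}
    (h : HasGradientAt f g (x + τ • v)) : HasDerivAt (fun t : ℝ => f (x + t • v)) ⟪g, v⟫ τ := by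
  have h1 : HasDerivAt (fun t : ℝ => x + t • v) v τ := by
    simpa using ((hasDerivAt_id τ).smul_const v).const_add x
  have h2 := h.hasFDerivAt.comp_hasDerivAt τ h1
  rw [InnerProductSpace.toDual_apply_apply] at h2
  exact h2

/-- Descent inequality along a segment. -/
theorem le_add_of_inner_gradient_le {f : V → ℝ} {g : V → V} (hf : ∀ x, HasGradientAt f (g x) x)
    {x v : V} {K : ℝ} (hK : ∀ τ ∈ Set.Icc (0 : ℝ) 1, ⟪g (x + τ • v), v⟫ ≤ ⟪g x, v⟫ + K * τ) :
    f (x + v) ≤ f x + ⟪g x, v⟫ + K / 2 := by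
  -- The subtracted quadratic is the primitive of the assumed bound on the slope, so the difference
  -- is antitone on [0, 1].
  have hd : ∀ τ : ℝ, HasDerivAt (fun t : ℝ => f (x + t • v) - (⟪g x, v⟫ * t + K / 2 * t ^ 2))
      (⟪g (x + τ • v), v⟫ - (⟪g x, v⟫ + K * τ)) τ := by
    intro τ
    refine (HasGradientAt.hasDerivAt_line (hf _)).sub ?_
    have h1 := ((hasDerivAt_id τ).const_mul ⟪g x, v⟫).add
      (((hasDerivAt_id τ).pow 2).const_mul (K / 2))
    refine h1.congr_deriv ?_
    simp
    ring
  have hanti : AntitoneOn (fun t : ℝ => f (x + t • v) - (⟪g x, v⟫ * t + K / 2 * t ^ 2))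
      (Set.Icc 0 1) := by
    refine antitoneOn_of_deriv_nonpos (convex_Icc 0 1)
      (fun τ _ => (hd τ).continuousAt.continuousWithinAt)
      (fun τ _ => (hd τ).differentiableAt.differentiableWithinAt) fun τ hτ => ?_
    rw [interior_Icc] at hτ
    rw [(hd τ).deriv]
    linarith [hK τ ⟨hτ.1.le, hτ.2.le⟩]
  have := hanti (Set.left_mem_Icc.2 zero_le_one) (Set.right_mem_Icc.2 zero_le_one) zero_le_one
  simp at this
  linarith

theorem IsSmooth.hasGradientAt {L : ℝ} {f : V → ℝ} (hf : IsSmooth L f) (x : V) :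
    HasGradientAt f (gradient f x) x := (hf.1 x).hasGradientAt

theorem IsSmooth.le_add {L : ℝ} {f : V → ℝ} (hf : IsSmooth L f) (x v : V) :
    f (x + v) ≤ f x + ⟪gradient f x, v⟫ + L / 2 * ‖v‖ ^ 2 := by
  have := le_add_of_inner_gradient_le hf.hasGradientAt (x := x) (v := v) (K := L * ‖v‖ ^ 2) ?_
  · linarith
  · intro τ hτ
    have h1 : ⟪gradient f (x + τ • v) - gradient f x, v⟫ ≤ L * ‖τ • v‖ * ‖v‖ := by
      refine (real_inner_le_norm _ _).trans ?_
      gcongr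
      simpa using hf.2 (x + τ • v) x
    rw [inner_sub_left, norm_smul, Real.norm_of_nonneg hτ.1] at h1
    nlinarith

theorem IsSmooth.gradient_neg {L : ℝ} {f : V → ℝ} (hf : IsSmooth L f) (x : V) :
    gradient (fun x => -f x) x = -gradient f x := by
  refine HasGradientAt.gradient ?_
  rw [hasGradientAt_iff_hasFDerivAt, map_neg]
  exact (hf.hasGradientAt x).hasFDerivAt.neg

theorem IsSmooth.neg {L : ℝ} {f : V → ℝ} (hf : IsSmooth L f) : IsSmooth L fun x => -f x := by
  refine ⟨hf.1.neg, fun z w => ?_⟩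
  rw [hf.gradient_neg, hf.gradient_neg, ← neg_sub', norm_neg]
  exact hf.2 z w

theorem IsSmooth.abs_sub_le {L : ℝ} {f : V → ℝ} (hf : IsSmooth L f) (x v : V) :
    |f (x + v) - f x - ⟪gradient f x, v⟫| ≤ L / 2 * ‖v‖ ^ 2 := by
  rw [abs_le]
  have h1 := hf.le_add x v
  have h2 := hf.neg.le_add x v
  rw [hf.gradient_neg, inner_neg_left] at h2
  constructor <;> linarith

theorem IsSmooth.continuous_gradient {L : ℝ} {f : V → ℝ} (hf : IsSmooth L f) :
    Continuous (gradient f) := by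
  refine (LipschitzWith.of_dist_le_mul (K := L.toNNReal) fun x y => ?_).continuous
  rw [dist_eq_norm, dist_eq_norm]
  refine (hf.2 x y).trans ?_
  gcongr
  exact Real.le_coe_toNNReal L

/-- A quadratic error is o(‖v‖). This yields gradients of expectations by integrating a pointwise
quadratic bound, without differentiating under the integral. -/
theorem hasGradientAt_of_abs_sub_le {f : V → ℝ} {x g : V} {K : ℝ}
    (h : ∀ v, |f (x + v) - f x - ⟪g, v⟫| ≤ K * ‖v‖ ^ 2) : HasGradientAt f g x := by
  rw [hasGradientAt_iff_isLittleO_nhds_zero]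
  refine (Asymptotics.IsBigO.of_bound K (Eventually.of_forall fun v => ?_)).trans_isLittleO
    (Asymptotics.isLittleO_norm_pow_id one_lt_two)
  simpa using h v

end Smooth

/-! ### The energy as a function of the conditioned parameter -/

variable {ν : Measure ℝ} {ell : EuclideanSpace ℝ (Fin d) → ℝ} {L : ℝ}

/-- The left side is a partial sum of the squared entries of the rank-one matrix (g_i u_j), whose
total is the right side. -/
theorem sum_mul_sq_add_sum_offDiag_le (u : Fin d → ℝ) (g : EuclideanSpace ℝ (Fin d)) :
    ∑ i, (u i * g i) ^ 2 + ∑ p : OffDiag fam d, (u p.1.2 * g p.1.1) ^ 2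
      ≤ (∑ l, u l ^ 2) * ‖g‖ ^ 2 := by
  rw [← sum_offDiag, ← Finset.sum_add_distrib, EuclideanSpace.real_norm_sq_eq, Finset.mul_sum]
  refine Finset.sum_le_sum fun i _ => ?_
  rw [Finset.sum_mul]
  have : (u i * g i) ^ 2 = ∑ j, if i = j then (u j * g i) ^ 2 else 0 := by simp
  rw [this, ← Finset.sum_add_distrib]
  refine Finset.sum_le_sum fun j _ => ?_
  rw [← mul_pow]
  by_cases hij : i = j
  · subst hij
    simp
  · simp only [hij, if_false, zero_add]
    split_ifs
    · exact le_rfl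
    · positivity

theorem continuous_linReparam_left (w : Param fam d) : Continuous fun u => linReparam u w :=
  continuous_linReparam_apply.comp (by fun_prop : Continuous fun u => (u, w))

theorem IsBaseLaw.memLp_linReparam (hν : IsBaseLaw ν) (w : Param fam d) :
    MemLp (fun u => linReparam u w) 2 (base d ν) :=
  (memLp_two_iff_integrable_sq_norm (continuous_linReparam_left w).aestronglyMeasurable).2
    (hν.hasMean_norm_linReparam_sq w).1

theorem IsSmooth.norm_gradient_sq_le (hell : IsSmooth L ell) (z w : EuclideanSpace ℝ (Fin d)) :
    ‖gradient ell z‖ ^ 2 ≤ 2 * ‖gradient ell w‖ ^ 2 + 2 * L ^ 2 * ‖z - w‖ ^ 2 := by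
  have h1 : ‖gradient ell z‖ ≤ ‖gradient ell w‖ + L * ‖z - w‖ := by
    have := norm_le_insert' (gradient ell z) (gradient ell w)
    linarith [hell.2 z w]
  nlinarith [norm_nonneg (gradient ell z), sq_nonneg (‖gradient ell w‖ - L * ‖z - w‖)]

theorem continuous_adjReparam_gradient (hell : IsSmooth L ell) :
    Continuous fun q : (Fin d → ℝ) × Param fam d =>
      (adjReparam q.1 (gradient ell (linReparam q.1 q.2)) : Param fam d) :=
  continuous_adjReparam.comp
    (continuous_fst.prodMk (hell.continuous_gradient.comp continuous_linReparam_apply))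

/-- The squared norm is at most (1 + ‖u‖²)‖∇ℓ‖², and ∇ℓ grows linearly around the location, so
fourth moments of u suffice. -/
theorem IsBaseLaw.memLp_adjReparam (hν : IsBaseLaw ν) (hell : IsSmooth L ell) (w : Param fam d) :
    MemLp (fun u => (adjReparam u (gradient ell (linReparam u w)) : Param fam d)) 2
      (base d ν) := by
  have := hν.isProb_base d
  have hc : Continuous fun u =>
      (adjReparam u (gradient ell (linReparam u w)) : Param fam d) := by
    have h : Continuous fun u => (u, gradient ell (linReparam u w)) :=
      continuous_id.prodMk (hell.continuous_gradient.comp (continuous_linReparam_left w))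
    exact continuous_adjReparam.comp h
  refine (memLp_two_iff_integrable_sq_norm hc.aestronglyMeasurable).2 ?_
  have hB := hν.hasMean_norm_linReparam_sq (centered w)
  have h := (((HasMean.const (ρ := base d ν) 1).add hν.hasMean_normSq).const_mul
    (2 * ‖gradient ell (loc w)‖ ^ 2)).add
    ((hB.add (hν.hasMean_normSq_mul_linReparam_centered w)).const_mul (2 * L ^ 2))
  refine h.1.mono' (hc.norm.pow 2).aestronglyMeasurable (Eventually.of_forall fun u => ?_)
  rw [Real.norm_of_nonneg (by positivity), adjReparam_norm_sq]
  have h1 := sum_mul_sq_add_sum_offDiag_le (fam := fam) u (gradient ell (linReparam u w))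
  have h2 := hell.norm_gradient_sq_le (linReparam u w) (loc w)
  rw [← linReparam_centered] at h2
  have h3 : 0 ≤ ∑ l, u l ^ 2 := Finset.sum_nonneg fun _ _ => sq_nonneg _
  nlinarith

/-- The energy as a function of the location-scale parameter. -/
noncomputable def meanEnergy (ν : Measure ℝ) (ell : EuclideanSpace ℝ (Fin d) → ℝ)
    (w : Param fam d) : ℝ :=
  ∫ u, ell (linReparam u w) ∂(base d ν)

/-- The gradient of `meanEnergy`. -/
noncomputable def meanGrad (ν : Measure ℝ) (ell : EuclideanSpace ℝ (Fin d) → ℝ)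
    (w : Param fam d) : Param fam d :=
  ∫ u, adjReparam u (gradient ell (linReparam u w)) ∂(base d ν)

theorem IsBaseLaw.integrable_adjReparam (hν : IsBaseLaw ν) (hell : IsSmooth L ell)
    (w : Param fam d) :
    Integrable (fun u => (adjReparam u (gradient ell (linReparam u w)) : Param fam d))
      (base d ν) := by
  have := hν.isProb_base d
  exact (hν.memLp_adjReparam hell w).integrable one_le_two

theorem IsBaseLaw.hasMean_inner_gradient (hν : IsBaseLaw ν) (hell : IsSmooth L ell)
    (w v : Param fam d) :
    HasMean (base d ν) (fun u => ⟪gradient ell (linReparam u w), linReparam u v⟫)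
      ⟪meanGrad ν ell w, v⟫ := by
  have hi := hν.integrable_adjReparam hell w
  have h : ∀ u, ⟪gradient ell (linReparam u w), linReparam u v⟫
      = ⟪v, adjReparam u (gradient ell (linReparam u w))⟫ := fun u => by
    rw [real_inner_comm, inner_linReparam]
  refine HasMean.congr ⟨hi.const_inner v, integral_inner hi v⟩ h ?_
  rw [real_inner_comm]
  rfl

theorem IsBaseLaw.hasMean_meanGrad_apply (hν : IsBaseLaw ν) (hell : IsSmooth L ell)
    (w : Param fam d) (c) :
    HasMean (base d ν)
      (fun u => (adjReparam u (gradient ell (linReparam u w)) : Param fam d) c)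
      (meanGrad ν ell w c) :=
  ⟨(EuclideanSpace.proj c : Param fam d →L[ℝ] ℝ).integrable_comp (hν.integrable_adjReparam hell w),
    (EuclideanSpace.proj c : Param fam d →L[ℝ] ℝ).integral_comp_comm
      (hν.integrable_adjReparam hell w)⟩

theorem IsBaseLaw.integrable_energy (hν : IsBaseLaw ν) (hell : IsSmooth L ell) (w : Param fam d) :
    Integrable (fun u => ell (linReparam u w)) (base d ν) := by
  have := hν.isProb_base d
  have hA := hν.memLp_linReparam w
  have h := ((integrable_const |ell 0|).add
    ((hA.integrable one_le_two).norm.const_mul ‖gradient ell 0‖)).add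
    ((hν.hasMean_norm_linReparam_sq w).1.const_mul (L / 2))
  refine h.mono' (hell.1.continuous.comp (continuous_linReparam_left w)).aestronglyMeasurable
    (Eventually.of_forall fun u => ?_)
  have h1 := hell.abs_sub_le 0 (linReparam u w)
  rw [zero_add] at h1
  have h2 := abs_real_inner_le_norm (gradient ell 0) (linReparam u w)
  simp only [Pi.add_apply, Real.norm_eq_abs]
  have h3 := abs_add_three (ell 0) ⟪gradient ell 0, linReparam u w⟫
    (ell (linReparam u w) - ell 0 - ⟪gradient ell 0, linReparam u w⟫)
  have h4 : ell 0 + ⟪gradient ell 0, linReparam u w⟫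
    + (ell (linReparam u w) - ell 0 - ⟪gradient ell 0, linReparam u w⟫) = ell (linReparam u w) := by
    ring
  rw [h4] at h3
  linarith

/-- Integrate the quadratic bound for ℓ at each u: the adjoint turns the linear term into
`meanGrad`, and the mean-square isometry turns the remainder into ‖v‖². -/
theorem IsBaseLaw.abs_meanEnergy_sub_le (hν : IsBaseLaw ν) (hell : IsSmooth L ell)
    (w v : Param fam d) :
    |meanEnergy ν ell (w + v) - meanEnergy ν ell w - ⟪meanGrad ν ell w, v⟫| ≤ L / 2 * ‖v‖ ^ 2 := by
  have h := ((hν.integrable_energy hell (w + v)).hasMean.sub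
    (hν.integrable_energy hell w).hasMean).sub (hν.hasMean_inner_gradient hell w v)
  have hb := (hν.hasMean_norm_linReparam_sq v).const_mul (L / 2)
  have key : ∀ u, |ell (linReparam u (w + v)) - ell (linReparam u w)
      - ⟪gradient ell (linReparam u w), linReparam u v⟫| ≤ L / 2 * ‖linReparam u v‖ ^ 2 := fun u => by
    rw [map_add]
    exact hell.abs_sub_le _ _
  rw [abs_le]
  constructor
  · have := (hb.const_mul (-1)).le h fun u => by linarith [(abs_le.1 (key u)).1]
    unfold meanEnergy
    linarith
  · exact h.le hb fun u => (abs_le.1 (key u)).2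

theorem IsBaseLaw.hasGradientAt_meanEnergy (hν : IsBaseLaw ν) (hell : IsSmooth L ell)
    (w : Param fam d) : HasGradientAt (meanEnergy ν ell) (meanGrad ν ell w) w :=
  hasGradientAt_of_abs_sub_le fun v => hν.abs_meanEnergy_sub_le hell w v

theorem IsBaseLaw.inner_meanGrad_sub_le (hν : IsBaseLaw ν) (hL : 0 ≤ L) (hell : IsSmooth L ell)
    (w w' v : Param fam d) :
    ⟪meanGrad ν ell w - meanGrad ν ell w', v⟫ ≤ L * (‖w - w'‖ * ‖v‖) := by
  rcases eq_or_ne (w - w') 0 with h0 | h0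
  · rw [sub_eq_zero] at h0
    simp [h0]
  rcases eq_or_ne v 0 with hv0 | hv0
  · simp [hv0]
  have ha : 0 < ‖w - w'‖ := norm_pos_iff.2 h0
  have hb : 0 < ‖v‖ := norm_pos_iff.2 hv0
  have h := (hν.hasMean_inner_gradient hell w v).sub (hν.hasMean_inner_gradient hell w' v)
  -- A weighted AM-GM replaces Cauchy–Schwarz for the expectation; with these weights both squares
  -- have mean ‖w − w'‖‖v‖.
  have h2 := (((hν.hasMean_norm_linReparam_sq (w - w')).const_mul (‖v‖ / ‖w - w'‖)).add
    ((hν.hasMean_norm_linReparam_sq v).const_mul (‖w - w'‖ / ‖v‖))).const_mul (L / 2)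
  have h3 := h.le h2 fun u => by
    rw [← inner_sub_left]
    refine (real_inner_le_norm _ _).trans ?_
    have h4 := hell.2 (linReparam u w) (linReparam u w')
    rw [← map_sub] at h4
    set a := ‖linReparam u (w - w')‖
    set b := ‖linReparam u v‖
    have h5 : ‖v‖ / ‖w - w'‖ * a ^ 2 + ‖w - w'‖ / ‖v‖ * b ^ 2 - 2 * (a * b)
        = (‖v‖ * a - ‖w - w'‖ * b) ^ 2 / (‖w - w'‖ * ‖v‖) := by
      field_simp
      ring
    have h6 : 0 ≤ (‖v‖ * a - ‖w - w'‖ * b) ^ 2 / (‖w - w'‖ * ‖v‖) := by positivity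
    calc _ ≤ L * a * b := by gcongr
      _ ≤ _ := by nlinarith
  rw [inner_sub_left]
  refine h3.trans (le_of_eq ?_)
  field_simp
  ring

theorem IsBaseLaw.norm_meanGrad_sub_le (hν : IsBaseLaw ν) (hL : 0 ≤ L) (hell : IsSmooth L ell)
    (w w' : Param fam d) : ‖meanGrad ν ell w - meanGrad ν ell w'‖ ≤ L * ‖w - w'‖ := by
  rcases (norm_nonneg (meanGrad ν ell w - meanGrad ν ell w')).eq_or_lt with h | h
  · rw [← h]
    positivity
  have := hν.inner_meanGrad_sub_le hL hell w w' (meanGrad ν ell w - meanGrad ν ell w')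
  rw [real_inner_self_eq_norm_sq, sq, ← mul_assoc] at this
  exact le_of_mul_le_mul_right this h

theorem IsBaseLaw.continuous_meanGrad (hν : IsBaseLaw ν) (hL : 0 ≤ L) (hell : IsSmooth L ell) :
    Continuous (meanGrad ν ell : Param fam d → Param fam d) := by
  refine (LipschitzWith.of_dist_le_mul (K := L.toNNReal) fun x y => ?_).continuous
  rw [dist_eq_norm, dist_eq_norm, Real.coe_toNNReal L hL]
  exact hν.norm_meanGrad_sub_le hL hell x y

/-! ### Smoothness of the energy -/

theorem inner_condDeriv_sub (φ : ℝ → ℝ) (a b g v : Param fam d) :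
    ⟪g, condDeriv φ a v - condDeriv φ b v⟫
      = ∑ i, g (Sum.inr (Sum.inl i)) * v (Sum.inr (Sum.inl i))
        * (deriv φ (a (Sum.inr (Sum.inl i))) - deriv φ (b (Sum.inr (Sum.inl i)))) := by
  simp only [param_inner, PiLp.sub_apply, condDeriv_inl, condDeriv_inr_inl, condDeriv_inr_inr,
    sub_self, mul_zero, Finset.sum_const_zero, zero_add, add_zero]
  exact Finset.sum_congr rfl fun i _ => by ring

variable {φ : ℝ → ℝ} {Lφ Ls : ℝ}

theorem continuous_reparam_right (φ : ℝ → ℝ) (lam : Param fam d) :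
    Continuous (reparam φ lam) := by
  rw [show reparam φ lam = fun u => linReparam u (condMap φ lam) from funext (reparam_eq φ lam)]
  exact continuous_linReparam_left _

theorem energy_eq (φ : ℝ → ℝ) (hell : Continuous ell) (lam : Param fam d) :
    energy ν φ ell lam = meanEnergy ν ell (condMap φ lam) := by
  unfold energy varDist meanEnergy
  rw [integral_map (continuous_reparam_right φ lam).aemeasurable hell.aestronglyMeasurable]
  simp only [reparam_eq]

theorem hasGradientAt_comp_condMap (hφ : Differentiable ℝ φ) {f : Param fam d → ℝ}
    {g lam : Param fam d} (hf : HasGradientAt f g (condMap φ lam)) :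
    HasGradientAt (fun l => f (condMap φ l)) (condDeriv φ lam g) lam := by
  rw [hasGradientAt_iff_hasFDerivAt]
  refine (hf.hasFDerivAt.comp lam (hasFDerivAt_condMap hφ lam)).congr_fderiv ?_
  ext v
  simp [inner_condDeriv]

theorem IsBaseLaw.hasGradientAt_energy (hν : IsBaseLaw ν) (hφ : Differentiable ℝ φ)
    (hell : IsSmooth L ell) (lam : Param fam d) :
    HasGradientAt (energy ν φ ell) (condDeriv φ lam (meanGrad ν ell (condMap φ lam))) lam := by
  rw [show (energy ν φ ell : Param fam d → ℝ) = fun l => meanEnergy ν ell (condMap φ l) from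
    funext (energy_eq φ hell.1.continuous)]
  exact hasGradientAt_comp_condMap hφ (hν.hasGradientAt_meanEnergy hell _)

/-- The factor φ''(s_i) does not depend on u and leaves the integral; what remains is the
s_i-coordinate of `meanGrad`. -/
theorem IsBaseLaw.abs_meanGrad_mul_le (hν : IsBaseLaw ν) (hell : IsSmooth L ell)
    (hgrad : ReparamGradientBound fam ν φ ell Ls) (lam : Param fam d) (i : Fin d) :
    |meanGrad ν ell (condMap φ lam) (Sum.inr (Sum.inl i))
      * deriv (deriv φ) (lam (Sum.inr (Sum.inl i)))| ≤ Ls := by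
  have h := hgrad lam i
  rw [integral_mul_const] at h
  rw [← (hν.hasMean_meanGrad_apply hell (condMap φ lam) (Sum.inr (Sum.inl i))).2]
  simpa only [reparam_eq, adjReparam_inr_inl, mul_comm, diagParam] using h

/-- The directional gradient along a segment changes for two reasons: `meanGrad` moves, at rate at
most L‖v‖², and the Jacobian of the conditioner moves, at rate at most Ls‖v‖². -/
theorem IsBaseLaw.energy_le_add (hν : IsBaseLaw ν) (hL : 0 ≤ L) (hell : IsSmooth L ell)
    (hφ : IsConditioner φ Lφ) (hLs : 0 ≤ Ls) (hgrad : ReparamGradientBound fam ν φ ell Ls)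
    (lam v : Param fam d) :
    energy ν φ ell (lam + v) ≤ energy ν φ ell lam
      + ⟪condDeriv φ lam (meanGrad ν ell (condMap φ lam)), v⟫ + (L + Ls) / 2 * ‖v‖ ^ 2 := by
  have := le_add_of_inner_gradient_le
    (hν.hasGradientAt_energy hφ.differentiable hell (fam := fam)) (x := lam) (v := v)
    (K := (L + Ls) * ‖v‖ ^ 2) ?_
  · linarith
  set mg : ℝ → Param fam d := fun τ => meanGrad ν ell (condMap φ (lam + τ • v)) with hmg
  set G : ℝ → ℝ := fun τ => ⟪condDeriv φ (lam + τ • v) (mg τ), v⟫ with hG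
  have hmgc : Continuous mg := (hν.continuous_meanGrad hL hell).comp
    ((continuous_condMap hφ.differentiable.continuous).comp (by fun_prop))
  have hGc : Continuous G := by
    refine Continuous.inner ((continuous_condDeriv_apply hφ.continuous_deriv).comp
      (Continuous.prodMk (by fun_prop) hmgc)) continuous_const
  -- `mg` is only known to be Lipschitz, so G need not be differentiable; bounding its right slopes
  -- suffices.
  have key := image_le_of_liminf_slope_right_le_deriv_boundary (f := G) (a := 0) (b := 1)
    (B := fun τ => G 0 + (L + Ls) * ‖v‖ ^ 2 * τ) (B' := fun _ => (L + Ls) * ‖v‖ ^ 2)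
    hGc.continuousOn (by simp) (by fun_prop)
    (fun x _ => by
      simpa using (((hasDerivAt_id x).const_mul ((L + Ls) * ‖v‖ ^ 2)).const_add
        (G 0)).hasDerivWithinAt) ?_
  · intro τ hτ
    have := key hτ
    simpa [hG, hmg] using this
  intro x _ r hr
  refine Eventually.frequently ?_
  set S : ℝ → ℝ := fun z => ∑ i, mg x (Sum.inr (Sum.inl i)) * v (Sum.inr (Sum.inl i))
    * deriv φ (lam (Sum.inr (Sum.inl i)) + z * v (Sum.inr (Sum.inl i))) with hS
  have hSd : HasDerivAt S (∑ i, mg x (Sum.inr (Sum.inl i)) * v (Sum.inr (Sum.inl i))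
      * (deriv (deriv φ) (lam (Sum.inr (Sum.inl i)) + x * v (Sum.inr (Sum.inl i)))
        * v (Sum.inr (Sum.inl i)))) x := by
    refine HasDerivAt.fun_sum fun i _ => HasDerivAt.const_mul _ ?_
    refine (hφ.differentiable_deriv _).hasDerivAt.comp x ?_
    simpa using ((hasDerivAt_id x).mul_const (v (Sum.inr (Sum.inl i)))).const_add
      (lam (Sum.inr (Sum.inl i)))
  have hSle : (∑ i, mg x (Sum.inr (Sum.inl i)) * v (Sum.inr (Sum.inl i))
      * (deriv (deriv φ) (lam (Sum.inr (Sum.inl i)) + x * v (Sum.inr (Sum.inl i)))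
        * v (Sum.inr (Sum.inl i)))) ≤ Ls * ‖v‖ ^ 2 := by
    refine le_trans ?_ (mul_le_mul_of_nonneg_left (sum_diag_sq_le v) hLs)
    rw [Finset.mul_sum]
    refine Finset.sum_le_sum fun i _ => ?_
    have h2 := (le_abs_self _).trans (hν.abs_meanGrad_mul_le hell hgrad (lam + x • v) i)
    have h3 := mul_le_mul_of_nonneg_right h2 (sq_nonneg (v (Sum.inr (Sum.inl i))))
    simp only [PiLp.add_apply, PiLp.smul_apply, smul_eq_mul] at h3
    simp only [hmg]
    linarith
  have hlim := (hasDerivAt_iff_tendsto_slope.1 hSd).mono_left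
    (nhdsWithin_mono x fun z (hz : x < z) => hz.ne')
  have hev := hlim.eventually_lt_const (u := r - L * ‖v‖ ^ 2) (by linarith)
  filter_upwards [hev, self_mem_nhdsWithin] with z hz hxz
  have hxz' : 0 < z - x := sub_pos.2 hxz
  rw [slope_def_field] at hz ⊢
  rw [div_lt_iff₀ hxz'] at hz ⊢
  -- Discrete product rule.
  have e1 : G z - G x = ⟪mg z - mg x, condDeriv φ (lam + z • v) v⟫ + (S z - S x) := by
    have h1 := inner_condDeriv_sub φ (lam + z • v) (lam + x • v) (mg x) v
    simp only [PiLp.add_apply, PiLp.smul_apply, smul_eq_mul] at h1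
    simp only [hG, hS, ← Finset.sum_sub_distrib, ← mul_sub, ← h1, inner_condDeriv, inner_sub_left,
      inner_sub_right]
    ring
  have e2 : ⟪mg z - mg x, condDeriv φ (lam + z • v) v⟫ ≤ L * ‖v‖ ^ 2 * (z - x) := by
    refine (hν.inner_meanGrad_sub_le hL hell _ _ _).trans ?_
    have h1 := norm_condMap_sub_le hφ (lam + z • v) (lam + x • v)
    have h2 : lam + z • v - (lam + x • v) = (z - x) • v := by
      rw [add_sub_add_left_eq_sub, sub_smul]
    rw [h2, norm_smul, Real.norm_of_nonneg hxz'.le] at h1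
    calc _ ≤ L * ((z - x) * ‖v‖ * ‖v‖) := by
          gcongr
          exact norm_condDeriv_le hφ _ _
      _ = _ := by ring
  nlinarith

end BBVI

namespace BBVI

open Filter Topology
open scoped RealInnerProductSpace

variable {fam : ScaleFamily} {d : ℕ}

/-! ### The entropy of the variational distribution -/

variable {ν : Measure ℝ} {φ : ℝ → ℝ} {Lφ : ℝ}

/-- It is enough to compare measures of boxes, where the integral of the product density factors. -/
theorem IsBaseLaw.base_eq_withDensity (hν : IsBaseLaw ν) :
    base d ν = (volume : Measure (Fin d → ℝ)).withDensity
      fun x => ENNReal.ofReal (∏ i, (ν.rnDeriv volume (x i)).toReal) := by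
  have := hν.isProb
  refine Measure.pi_eq fun s hs => ?_
  have hint : Integrable (fun x => (ν.rnDeriv volume x).toReal) volume :=
    Measure.integrable_toReal_rnDeriv
  rw [withDensity_apply _ (MeasurableSet.univ_pi hs), volume_pi, Measure.restrict_pi_pi,
    ← ofReal_integral_eq_lintegral_ofReal
      (Integrable.fintype_prod fun i => hint.integrableOn)
      (Eventually.of_forall fun x => Finset.prod_nonneg fun i _ => ENNReal.toReal_nonneg),
    integral_fintype_prod_eq_prod (fun _ x => (ν.rnDeriv volume x).toReal),
    ENNReal.ofReal_prod_of_nonneg fun i _ => integral_nonneg fun x => ENNReal.toReal_nonneg]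
  refine Finset.prod_congr rfl fun i _ => ?_
  rw [Measure.setIntegral_toReal_rnDeriv hν.absCont, ofReal_measureReal]

theorem IsBaseLaw.base_absolutelyContinuous (hν : IsBaseLaw ν) :
    base d ν ≪ (volume : Measure (Fin d → ℝ)) := by
  rw [hν.base_eq_withDensity]
  exact withDensity_absolutelyContinuous _ _

theorem toReal_rnDeriv_pos {α : Type*} [MeasurableSpace α] {q ρ : Measure α} [SigmaFinite q]
    [SigmaFinite ρ] (h : q ≪ ρ) : ∀ᵐ x ∂q, 0 < (q.rnDeriv ρ x).toReal := by
  filter_upwards [Measure.rnDeriv_pos h, h.ae_le (q.rnDeriv_lt_top ρ)] with x h1 h2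
  exact ENNReal.toReal_pos h1.ne' h2.ne

theorem IsBaseLaw.integrable_log_base_density (hν : IsBaseLaw ν) :
    Integrable (fun u => Real.log (((base d ν).rnDeriv volume u).toReal)) (base d ν) := by
  have := hν.isProb
  have := hν.isProb_base d
  have h1 : Integrable (fun u => ∑ i, Real.log ((ν.rnDeriv volume (u i)).toReal)) (base d ν) :=
    integrable_finsetSum _ fun i _ =>
      (measurePreserving_eval (fun _ : Fin d => ν) i).integrable_comp_of_integrable
        hν.integrable_log_density
  refine h1.congr ?_
  have h2 : (base d ν).rnDeriv volume =ᵐ[volume]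
      fun x => ENNReal.ofReal (∏ i, (ν.rnDeriv volume (x i)).toReal) := by
    conv_lhs => rw [hν.base_eq_withDensity]
    exact Measure.rnDeriv_withDensity _ (by fun_prop)
  have h3 : ∀ᵐ u ∂(base d ν), ∀ i, 0 < (ν.rnDeriv volume (u i)).toReal := by
    rw [ae_all_iff]
    intro i
    exact (measurePreserving_eval (fun _ : Fin d => ν) i).quasiMeasurePreserving.ae
      (toReal_rnDeriv_pos hν.absCont)
  filter_upwards [hν.base_absolutelyContinuous.ae_le h2, h3] with u hu hpos
  rw [hu, ENNReal.toReal_ofReal (Finset.prod_nonneg fun i _ => (hpos i).le),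
    Real.log_prod fun i _ => (hpos i).ne']

theorem det_scale (φ : ℝ → ℝ) (lam : Param fam d) :
    (scale φ lam).det = ∏ i, φ (lam (Sum.inr (Sum.inl i))) := by
  rw [Matrix.det_of_isLowerTriangular]
  · simp [scale, diagParam]
  · intro i j hij
    have hij' : i < j := hij
    simp [scale, hij'.ne, hij'.not_gt]

theorem IsConditioner.det_scale_pos (hφ : IsConditioner φ Lφ) (lam : Param fam d) :
    0 < (scale φ lam).det := by
  rw [det_scale]
  exact Finset.prod_pos fun i _ => hφ.pos _

theorem IsConditioner.measurableEmbedding_reparam (hφ : IsConditioner φ Lφ) (lam : Param fam d) :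
    MeasurableEmbedding (reparam φ lam) := by
  refine (continuous_reparam_right φ lam).measurableEmbedding fun u u' h => ?_
  have h1 : (scale φ lam).mulVec u = (scale φ lam).mulVec u' := by
    simpa [reparam] using h
  exact Matrix.mulVec_injective_of_isUnit ((Matrix.isUnit_iff_isUnit_det _).2
    (hφ.det_scale_pos lam).ne'.isUnit) h1

theorem IsConditioner.map_reparam_volume (hφ : IsConditioner φ Lφ) (lam : Param fam d) :
    (volume : Measure (Fin d → ℝ)).map (reparam φ lam)
      = ENNReal.ofReal (scale φ lam).det⁻¹ • volume := by
  have h1 : reparam φ lam = (fun z => z + loc lam) ∘ (WithLp.toLp 2 : (Fin d → ℝ) → _)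
      ∘ Matrix.toLin' (scale φ lam) := by
    ext u
    simp [reparam]
  have hm : Measurable (Matrix.toLin' (scale φ lam)) :=
    (LinearMap.continuous_of_finiteDimensional _).measurable
  have ht : Measurable (WithLp.toLp 2 : (Fin d → ℝ) → EuclideanSpace ℝ (Fin d)) :=
    (PiLp.continuous_toLp 2 _).measurable
  rw [h1, ← Measure.map_map (by fun_prop) (ht.comp hm), ← Measure.map_map ht hm,
    Real.map_matrix_volume_pi_eq_smul_volume_pi (hφ.det_scale_pos lam).ne', Measure.map_smul,
    (PiLp.volume_preserving_toLp (Fin d)).map_eq, Measure.map_smul,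
    map_add_right_eq_self, abs_of_pos (inv_pos.2 (hφ.det_scale_pos lam))]

theorem IsBaseLaw.isProb_varDist (hν : IsBaseLaw ν) (φ : ℝ → ℝ) (lam : Param fam d) :
    IsProbabilityMeasure (varDist ν φ lam) := by
  have := hν.isProb_base d
  exact Measure.isProbabilityMeasure_map (continuous_reparam_right φ lam).aemeasurable

theorem IsBaseLaw.varDist_absolutelyContinuous (hν : IsBaseLaw ν) (hφ : IsConditioner φ Lφ)
    (lam : Param fam d) : varDist ν φ lam ≪ volume := by
  have h := hν.base_absolutelyContinuous.map (f := reparam φ lam)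
    (continuous_reparam_right φ lam).measurable
  rw [hφ.map_reparam_volume] at h
  exact h.trans Measure.smul_absolutelyContinuous

/-- Change of variables: the affine map scales Lebesgue measure by the inverse determinant, and the
scale is triangular with diagonal φ(s_i), also for Cholesky. -/
theorem IsBaseLaw.log_varDist_density (hν : IsBaseLaw ν) (hφ : IsConditioner φ Lφ)
    (lam : Param fam d) :
    ∀ᵐ u ∂(base d ν), Real.log (((varDist ν φ lam).rnDeriv volume (reparam φ lam u)).toReal)
      = Real.log (((base d ν).rnDeriv volume u).toReal)
        - ∑ i, Real.log (φ (lam (Sum.inr (Sum.inl i)))) := by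
  have := hν.isProb_base d
  have := hν.isProb_varDist φ lam
  set c : ENNReal := ENNReal.ofReal (scale φ lam).det⁻¹ with hc
  have hdet := inv_pos.2 (hφ.det_scale_pos lam)
  have hc0 : c ≠ 0 := (ENNReal.ofReal_pos.2 hdet).ne'
  have hct : c ≠ ⊤ := ENNReal.ofReal_ne_top
  have h1 := (hφ.measurableEmbedding_reparam lam).rnDeriv_map (base d ν) volume
  have h2 : ∀ᵐ z ∂((volume : Measure (Fin d → ℝ)).map (reparam φ lam)),
      (varDist ν φ lam).rnDeriv (c • volume) z = c⁻¹ * (varDist ν φ lam).rnDeriv volume z := by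
    rw [hφ.map_reparam_volume, Measure.ae_ennreal_smul_measure_iff hc0]
    exact Measure.rnDeriv_smul_right_of_ne_top _ _ hc0 hct
  have h3 := ae_of_ae_map (continuous_reparam_right φ lam).aemeasurable h2
  filter_upwards [hν.base_absolutelyContinuous.ae_le h1, hν.base_absolutelyContinuous.ae_le h3,
    toReal_rnDeriv_pos (hν.base_absolutelyContinuous (d := d))] with u h1 h3 h4
  rw [hφ.map_reparam_volume] at h1
  have h5 : (varDist ν φ lam).rnDeriv volume (reparam φ lam u)
      = c * (base d ν).rnDeriv volume u := by
    rw [← h1]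
    change _ = c * (varDist ν φ lam).rnDeriv (c • volume) (reparam φ lam u)
    rw [h3, ← mul_assoc, ENNReal.mul_inv_cancel hc0 hct, one_mul]
  rw [h5, ENNReal.toReal_mul, hc, ENNReal.toReal_ofReal hdet.le, Real.log_mul hdet.ne' h4.ne',
    Real.log_inv, det_scale, Real.log_prod fun i _ => (hφ.pos _).ne']
  ring

theorem IsBaseLaw.integrable_log_varDist_density (hν : IsBaseLaw ν) (hφ : IsConditioner φ Lφ)
    (lam : Param fam d) :
    Integrable (fun z => Real.log (((varDist ν φ lam).rnDeriv volume z).toReal))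
      (varDist ν φ lam) := by
  have := hν.isProb_base d
  refine (integrable_map_measure (Measurable.aestronglyMeasurable (by fun_prop))
    (continuous_reparam_right φ lam).aemeasurable).2 ?_
  refine (hν.integrable_log_base_density.sub (integrable_const
    (∑ i, Real.log (φ (lam (Sum.inr (Sum.inl i))))))).congr ?_
  filter_upwards [hν.log_varDist_density hφ lam] with u hu
  simp [hu]

theorem IsBaseLaw.negEntropy_eq (hν : IsBaseLaw ν) (hφ : IsConditioner φ Lφ)
    (lam : Param fam d) :
    negEntropy ν φ lam = -diffEntropy (base d ν)
      - ∑ i, Real.log (φ (lam (Sum.inr (Sum.inl i)))) := by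
  have := hν.isProb_base d
  unfold negEntropy diffEntropy
  conv_lhs => rw [varDist]
  rw [integral_map (continuous_reparam_right φ lam).aemeasurable
    (Measurable.aestronglyMeasurable (by fun_prop)), neg_neg, neg_neg]
  change ∫ u, Real.log (((varDist ν φ lam).rnDeriv volume (reparam φ lam u)).toReal) ∂_ = _
  rw [integral_congr_ae (hν.log_varDist_density hφ lam),
    integral_sub hν.integrable_log_base_density (integrable_const _)]
  simp

/-- The gradient of `negEntropy`. -/
noncomputable def entropyGrad (φ : ℝ → ℝ) (lam : Param fam d) : Param fam d :=
  WithLp.toLp 2 fun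
    | Sum.inl _ => 0
    | Sum.inr (Sum.inl i) => -gradient (fun x => Real.log (φ x)) (lam (Sum.inr (Sum.inl i)))
    | Sum.inr (Sum.inr _) => 0

theorem continuous_entropyGrad (hφ : IsConditioner φ Lφ) :
    Continuous (entropyGrad φ : Param fam d → Param fam d) := by
  have := hφ.logSmooth.continuous_gradient
  refine (PiLp.continuous_toLp 2 _).comp (continuous_pi ?_)
  rintro (i | i | p) <;> simp only <;> fun_prop

theorem inner_entropyGrad (φ : ℝ → ℝ) (lam v : Param fam d) :
    ⟪entropyGrad φ lam, v⟫ = ∑ i, -gradient (fun x => Real.log (φ x))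
      (lam (Sum.inr (Sum.inl i))) * v (Sum.inr (Sum.inl i)) := by
  simp [param_inner, entropyGrad]

theorem IsBaseLaw.abs_negEntropy_sub_le (hν : IsBaseLaw ν) (hLφ : 0 ≤ Lφ)
    (hφ : IsConditioner φ Lφ) (lam v : Param fam d) :
    |negEntropy ν φ (lam + v) - negEntropy ν φ lam - ⟪entropyGrad φ lam, v⟫|
      ≤ Lφ / 2 * ‖v‖ ^ 2 := by
  have h : negEntropy ν φ (lam + v) - negEntropy ν φ lam - ⟪entropyGrad φ lam, v⟫
      = ∑ i, -(Real.log (φ (lam (Sum.inr (Sum.inl i)) + v (Sum.inr (Sum.inl i))))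
        - Real.log (φ (lam (Sum.inr (Sum.inl i))))
        - ⟪gradient (fun x => Real.log (φ x)) (lam (Sum.inr (Sum.inl i))),
          v (Sum.inr (Sum.inl i))⟫) := by
    rw [hν.negEntropy_eq hφ, hν.negEntropy_eq hφ, inner_entropyGrad]
    simp only [neg_sub, Finset.sum_sub_distrib, Finset.sum_neg_distrib, neg_mul, PiLp.add_apply,
      RCLike.inner_apply, conj_trivial]
    simp only [mul_comm]
    ring
  rw [h]
  refine (Finset.abs_sum_le_sum_abs _ _).trans ?_
  refine le_trans ?_ (mul_le_mul_of_nonneg_left (sum_diag_sq_le v) (by positivity))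
  rw [Finset.mul_sum]
  refine Finset.sum_le_sum fun i _ => ?_
  rw [abs_neg, ← sq_abs (v _), ← Real.norm_eq_abs (v _)]
  exact hφ.logSmooth.abs_sub_le _ _

theorem IsBaseLaw.hasGradientAt_negEntropy (hν : IsBaseLaw ν) (hLφ : 0 ≤ Lφ)
    (hφ : IsConditioner φ Lφ) (lam : Param fam d) :
    HasGradientAt (negEntropy ν φ) (entropyGrad φ lam) lam :=
  hasGradientAt_of_abs_sub_le fun v => hν.abs_negEntropy_sub_le hLφ hφ lam v

theorem IsBaseLaw.negEntropy_add_shift (hν : IsBaseLaw ν) (hφ : IsConditioner φ Lφ)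
    (lam : Param fam d) (b : EuclideanSpace ℝ (Fin d)) :
    negEntropy ν φ (lam + shift b) = negEntropy ν φ lam := by
  simp [hν.negEntropy_eq hφ]

/-! ### Lower bounds on the negative ELBO -/

/-- Gibbs' inequality: nonnegativity of a relative entropy. -/
theorem integral_add_integral_log_rnDeriv_nonneg {α : Type*} [MeasurableSpace α] {q ρ : Measure α}
    [IsProbabilityMeasure q] [SigmaFinite ρ] (hq : q ≪ ρ) {prior f : α → ℝ}
    (hprior : ∀ z, 0 < prior z) (hmeas : Measurable prior)
    (hone : ∫⁻ z, ENNReal.ofReal (prior z) ∂ρ ≤ 1) (hf : Integrable f q)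
    (hlog : Integrable (fun z => Real.log ((q.rnDeriv ρ z).toReal)) q)
    (hle : ∀ z, -Real.log (prior z) ≤ f z) :
    0 ≤ ∫ z, f z ∂q + ∫ z, Real.log ((q.rnDeriv ρ z).toReal) ∂q := by
  -- The inequality is log R ≤ R − 1 integrated against q, where R has q-mean at most the mass of
  -- the prior.
  set R : α → ℝ := fun z => prior z / (q.rnDeriv ρ z).toReal with hR
  have hRm : Measurable R := by fun_prop
  have hR0 : ∀ z, 0 ≤ R z := fun z => div_nonneg (hprior z).le ENNReal.toReal_nonneg
  have hlint : ∫⁻ z, ENNReal.ofReal (R z) ∂q ≤ 1 := by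
    rw [← lintegral_rnDeriv_mul hq hRm.ennreal_ofReal.aemeasurable]
    refine (lintegral_mono fun z => ?_).trans hone
    -- At an infinite derivative `toReal` is 0, so R is 0 by the convention for division by zero and
    -- the product ⊤ * 0 vanishes.
    rcases eq_or_ne (q.rnDeriv ρ z) ⊤ with h | h
    · simp [hR, h]
    rcases eq_or_ne (q.rnDeriv ρ z) 0 with h0 | h0
    · simp [h0]
    have hpos := ENNReal.toReal_pos h0 h
    conv_lhs => rw [← ENNReal.ofReal_toReal h]
    rw [← ENNReal.ofReal_mul ENNReal.toReal_nonneg]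
    refine ENNReal.ofReal_le_ofReal (le_of_eq ?_)
    simp only [hR]
    field_simp
  have hRi : Integrable R q :=
    ⟨hRm.aestronglyMeasurable, by
      rw [hasFiniteIntegral_iff_ofReal (Eventually.of_forall hR0)]
      exact hlint.trans_lt ENNReal.one_lt_top⟩
  have hRle : ∫ z, R z ∂q ≤ 1 := by
    rw [integral_eq_lintegral_of_nonneg_ae (Eventually.of_forall hR0) hRm.aestronglyMeasurable]
    exact ENNReal.toReal_le_of_le_ofReal zero_le_one (by simpa using hlint)
  rw [← integral_add hf hlog]
  have h1 : ∫ z, (1 - R z) ∂q ≤ ∫ z, (f z + Real.log ((q.rnDeriv ρ z).toReal)) ∂q := by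
    refine integral_mono_ae ((integrable_const 1).sub hRi) (hf.add hlog) ?_
    filter_upwards [toReal_rnDeriv_pos hq] with z hz
    have h2 := Real.log_le_sub_one_of_pos (div_pos (hprior z) hz)
    rw [Real.log_div (hprior z).ne' hz.ne'] at h2
    have := hle z
    simp only [hR]
    linarith
  rw [integral_sub (integrable_const 1) hRi] at h1
  simp at h1
  linarith

variable {lik prior : EuclideanSpace ℝ (Fin d) → ℝ} {zlike : EuclideanSpace ℝ (Fin d)} {μ L : ℝ}

theorem QuadraticallyGrowing.le_of_minimizers_eq {f : EuclideanSpace ℝ (Fin d) → ℝ}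
    (h : QuadraticallyGrowing μ f) (hz : minimizers f = {zlike}) (z : EuclideanSpace ℝ (Fin d)) :
    μ / 2 * ‖z - zlike‖ ^ 2 ≤ f z - ⨅ w, f w := by
  refine h.2 z zlike ?_
  rw [hz]
  exact ⟨rfl, by rintro q rfl; rfl⟩

theorem negLogJoint_eq (hlik : ∀ z, 0 < lik z) (hprior : ∀ z, 0 < prior z)
    (z : EuclideanSpace ℝ (Fin d)) :
    negLogJoint lik prior z = negLogLik lik z - Real.log (prior z) := by
  unfold negLogJoint negLogLik
  rw [Real.log_mul (hlik z).ne' (hprior z).ne']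
  ring

/-- Apply Gibbs' inequality to the joint loss minus the quadratic lower bound for ℓ_like, which
still dominates −log prior. The mean of ‖z − zlike‖² is ‖C‖_F² + ‖m − zlike‖²; only the first part
is kept. -/
theorem IsBaseLaw.add_norm_centered_sq_le_negElbo (hν : IsBaseLaw ν) (hφ : IsConditioner φ Lφ)
    (hlik : ∀ z, 0 < lik z) (hprior : ∀ z, 0 < prior z) (hprior_meas : Measurable prior)
    (hprior_one : ∫⁻ z, ENNReal.ofReal (prior z) = 1)
    (hsmooth : IsSmooth L (negLogJoint lik prior)) (hμ : 0 < μ)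
    (hgrowth : QuadraticallyGrowing μ (negLogLik lik))
    (hzlike : minimizers (negLogLik lik) = {zlike}) (lam : Param fam d) :
    (⨅ z, negLogLik lik z) + μ / 2 * ‖centered (condMap φ lam)‖ ^ 2
      ≤ negElbo ν φ (negLogJoint lik prior) lam := by
  have := hν.isProb_base d
  have := hν.isProb_varDist φ lam
  have hT := (continuous_reparam_right φ lam).aemeasurable (μ := base d ν)
  have hell : Integrable (negLogJoint lik prior) (varDist ν φ lam) := by
    refine (integrable_map_measure hsmooth.1.continuous.aestronglyMeasurable hT).2 ?_
    simpa only [Function.comp_def, reparam_eq] using hν.integrable_energy hsmooth (condMap φ lam)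
  have hsq := hν.hasMean_norm_linReparam_sq (condMap φ lam - shift zlike)
  have hsq' : HasMean (varDist ν φ lam) (fun z => ‖z - zlike‖ ^ 2)
      (‖condMap φ lam - shift zlike‖ ^ 2) := by
    have e : ∀ u, ‖reparam φ lam u - zlike‖ ^ 2
        = ‖linReparam u (condMap φ lam - shift zlike)‖ ^ 2 := fun u => by
      rw [map_sub, linReparam_shift, reparam_eq]
    constructor
    · refine (integrable_map_measure (by fun_prop) hT).2 ?_
      simpa only [Function.comp_def, e] using hsq.1
    · rw [varDist, integral_map hT (by fun_prop)]
      simpa only [e] using hsq.2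
  have h1 := (hell.hasMean.sub (HasMean.const (⨅ z, negLogLik lik z))).sub
    (hsq'.const_mul (μ / 2))
  have h2 := integral_add_integral_log_rnDeriv_nonneg (hν.varDist_absolutelyContinuous hφ lam)
    hprior hprior_meas hprior_one.le h1.1 (hν.integrable_log_varDist_density hφ lam) fun z => by
      have := hgrowth.le_of_minimizers_eq hzlike z
      rw [negLogJoint_eq hlik hprior]
      linarith
  rw [h1.2] at h2
  have h3 : condMap φ lam - shift zlike
      = centered (condMap φ lam) + shift (loc (condMap φ lam) - zlike) := by
    ext (i | i | p) <;> simp [centered]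
  rw [h3, norm_centered_add_shift_sq] at h2
  simp only [negElbo, energy, negEntropy, diffEntropy, neg_neg]
  nlinarith [sq_nonneg ‖loc (condMap φ lam) - zlike‖]

/-- A probability density cannot be bounded below by a Gaussian-type function with a nonnegative
quadratic part. -/
theorem quadraticGrowth_le_smoothness (hd : 0 < d)
    (hlik : ∀ z, 0 < lik z) (hprior : ∀ z, 0 < prior z) (hprior_meas : Measurable prior)
    (hprior_one : ∫⁻ z, ENNReal.ofReal (prior z) = 1)
    (hsmooth : IsSmooth L (negLogJoint lik prior))
    (hgrowth : QuadraticallyGrowing μ (negLogLik lik))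
    (hzlike : minimizers (negLogLik lik) = {zlike}) : μ ≤ L := by
  by_contra! hlt
  have : Nonempty (Fin d) := ⟨⟨0, hd⟩⟩
  set K : ℝ := (⨅ w, negLogLik lik w) + μ / 2 * ‖zlike‖ ^ 2 - negLogJoint lik prior 0 with hK
  -- The log prior is ℓ_like − ℓ: growth bounds the first from below, smoothness at 0 the second
  -- from above, and the leftover (μ − L)/2 ‖z‖² is dropped.
  have h1 : ∀ z, K - μ * ⟪z, zlike⟫ - ⟪gradient (negLogJoint lik prior) 0, z⟫
      ≤ Real.log (prior z) := by
    intro z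
    have h2 := hsmooth.le_add 0 z
    rw [zero_add, negLogJoint_eq hlik hprior z] at h2
    have h3 := hgrowth.le_of_minimizers_eq hzlike z
    rw [norm_sub_sq_real] at h3
    nlinarith [sq_nonneg ‖z‖]
  -- The linear terms are odd, so at z or at −z they do not lower the bound below K.
  have h2 : ∀ z, Real.exp K ≤ prior z + prior (-z) := by
    intro z
    have ha := h1 z
    have hb := h1 (-z)
    rw [inner_neg_left, inner_neg_right] at hb
    have hz := hprior z
    have hz' := hprior (-z)
    by_cases h : K ≤ Real.log (prior z)
    · have := (Real.le_log_iff_exp_le hz).1 h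
      linarith
    · have := (Real.le_log_iff_exp_le hz').1 (show K ≤ Real.log (prior (-z)) by linarith)
      linarith
  have h3 : ∫⁻ _ : EuclideanSpace ℝ (Fin d), ENNReal.ofReal (Real.exp K)
      ≤ ∫⁻ z, (ENNReal.ofReal (prior z) + ENNReal.ofReal (prior (-z))) := by
    refine lintegral_mono fun z => ?_
    rw [← ENNReal.ofReal_add (hprior z).le (hprior _).le]
    exact ENNReal.ofReal_le_ofReal (h2 z)
  -- A positive constant has infinite integral since d > 0, while the right side is 2.
  rw [lintegral_const, measure_univ_of_isAddLeftInvariant,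
    ENNReal.mul_top (ENNReal.ofReal_pos.2 (Real.exp_pos K)).ne',
    lintegral_add_left hprior_meas.ennreal_ofReal,
    lintegral_neg_eq_self (fun z => ENNReal.ofReal (prior z)), hprior_one] at h3
  norm_num at h3

end BBVI

namespace BBVI

open Filter Topology
open scoped RealInnerProductSpace

variable {fam : ScaleFamily} {d : ℕ}

/-! ### Variance of the reparameterization gradient -/

/-- Bias-variance decomposition. -/
theorem hasMean_norm_sub_sq {α : Type*} [MeasurableSpace α] {ρ : Measure α}
    [IsProbabilityMeasure ρ] {V : Type*} [NormedAddCommGroup V] [InnerProductSpace ℝ V]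
    [CompleteSpace V] {Z : α → V} (hZ : MemLp Z 2 ρ) (c : V) :
    HasMean ρ (fun x => ‖Z x - c‖ ^ 2)
      (∫ x, ‖Z x - ∫ y, Z y ∂ρ‖ ^ 2 ∂ρ + ‖∫ y, Z y ∂ρ - c‖ ^ 2) := by
  set m := ∫ y, Z y ∂ρ with hm
  have hi : Integrable Z ρ := hZ.integrable one_le_two
  have h1 : HasMean ρ (fun x => ‖Z x - m‖ ^ 2) (∫ x, ‖Z x - m‖ ^ 2 ∂ρ) :=
    (hZ.sub (memLp_const m)).integrable_norm_pow two_ne_zero |>.hasMean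
  have h2 : HasMean ρ (fun x => ⟪m - c, Z x - m⟫) 0 := by
    have hs : Integrable (fun x => Z x - m) ρ := hi.sub (integrable_const m)
    refine ⟨hs.const_inner _, ?_⟩
    rw [integral_inner hs, integral_sub hi (integrable_const m)]
    simp [← hm]
  refine ((h1.add (h2.const_mul 2)).add (HasMean.const (‖m - c‖ ^ 2))).congr (fun x => ?_) (by ring)
  rw [← sub_add_sub_cancel (Z x) m c, norm_add_sq_real, real_inner_comm]

variable {ν : Measure ℝ} {ell : EuclideanSpace ℝ (Fin d) → ℝ} {L : ℝ}

theorem IsBaseLaw.memLp_gradient (hν : IsBaseLaw ν) (hell : IsSmooth L ell) (w : Param fam d) :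
    MemLp (fun u => gradient ell (linReparam u w)) 2 (base d ν) := by
  refine (hν.memLp_adjReparam hell w).of_le
    (hell.continuous_gradient.comp (continuous_linReparam_left w)).aestronglyMeasurable
    (Eventually.of_forall fun u => ?_)
  refine le_of_sq_le_sq ?_ (norm_nonneg _)
  rw [adjReparam_norm_sq]
  have : 0 ≤ ∑ p : OffDiag fam d, (u p.1.2 * gradient ell (linReparam u w) p.1.1) ^ 2 :=
    Finset.sum_nonneg fun _ _ => sq_nonneg _
  have : 0 ≤ ∑ i, (u i * gradient ell (linReparam u w) i) ^ 2 :=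
    Finset.sum_nonneg fun _ _ => sq_nonneg _
  linarith

theorem IsBaseLaw.integral_gradient (hν : IsBaseLaw ν) (hell : IsSmooth L ell) (w : Param fam d) :
    ∫ u, gradient ell (linReparam u w) ∂(base d ν) = loc (meanGrad ν ell w) := by
  have := hν.isProb_base d
  ext i
  have h := (EuclideanSpace.proj i : EuclideanSpace ℝ (Fin d) →L[ℝ] ℝ).integral_comp_comm
    ((hν.memLp_gradient hell w).integrable one_le_two)
  refine h.symm.trans ?_
  exact (hν.hasMean_meanGrad_apply hell w (Sum.inl i)).2

/-- Deviation of the gradient from its mean. -/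
noncomputable def gradDev (ν : Measure ℝ) (ell : EuclideanSpace ℝ (Fin d) → ℝ) (w : Param fam d)
    (u : Fin d → ℝ) : EuclideanSpace ℝ (Fin d) :=
  gradient ell (linReparam u w) - loc (meanGrad ν ell w)

/-- Jensen with an independent copy u': the deviation at u is at most the mean over u' of L²‖C(u' −
u)‖². Being pointwise in u, the bound can be multiplied by powers of u before integrating. -/
theorem IsBaseLaw.norm_gradDev_sq_le (hν : IsBaseLaw ν) (hell : IsSmooth L ell)
    (w : Param fam d) (u : Fin d → ℝ) :
    ‖gradDev ν ell w u‖ ^ 2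
      ≤ L ^ 2 * (‖linReparam u (centered w)‖ ^ 2 + ‖centered w‖ ^ 2) := by
  have := hν.isProb_base d
  have h1 := hasMean_norm_sub_sq (hν.memLp_gradient hell w) (gradient ell (linReparam u w))
  rw [hν.integral_gradient hell] at h1
  set b := linReparam u (centered w)
  have h2 := (hν.hasMean_norm_linReparam_sq (centered w + shift (-b))).const_mul (L ^ 2)
  have h3 := h1.le h2 fun u' => by
    have e : linReparam u' (centered w + shift (-b)) = linReparam u' w - linReparam u w := by
      rw [map_add, linReparam_shift, linReparam_centered, show b = _ from linReparam_centered u w]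
      abel
    rw [e, ← mul_pow]
    exact pow_le_pow_left₀ (norm_nonneg _) (hell.2 _ _) 2
  rw [norm_centered_add_shift_sq, norm_neg] at h3
  have h4 : 0 ≤ ∫ x, ‖gradient ell (linReparam x w) - loc (meanGrad ν ell w)‖ ^ 2 ∂(base d ν) :=
    integral_nonneg fun _ => by positivity
  rw [gradDev, norm_sub_rev]
  linarith

theorem IsBaseLaw.memLp_gradDev (hν : IsBaseLaw ν) (hell : IsSmooth L ell) (w : Param fam d) :
    MemLp (gradDev ν ell w) 2 (base d ν) := by
  have := hν.isProb_base d
  exact (hν.memLp_gradient hell w).sub (memLp_const _)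

/-- A variance is at most the second moment about any point; here the point is the gradient at the
location. -/
theorem IsBaseLaw.hasMean_norm_gradDev_sq (hν : IsBaseLaw ν) (hell : IsSmooth L ell)
    (w : Param fam d) :
    ∃ σ ≤ L ^ 2 * ‖centered w‖ ^ 2, HasMean (base d ν) (fun u => ‖gradDev ν ell w u‖ ^ 2) σ := by
  have := hν.isProb_base d
  refine ⟨_, ?_, ((hν.memLp_gradDev hell w).integrable_norm_pow two_ne_zero).hasMean⟩
  have h1 := hasMean_norm_sub_sq (hν.memLp_gradient hell w) (gradient ell (loc w))
  rw [hν.integral_gradient hell] at h1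
  have h3 := h1.le ((hν.hasMean_norm_linReparam_sq (centered w)).const_mul (L ^ 2)) fun u => by
    rw [linReparam_centered, ← mul_pow]
    exact pow_le_pow_left₀ (norm_nonneg _) (hell.2 _ _) 2
  have h4 : 0 ≤ ‖loc (meanGrad ν ell w) - gradient ell (loc w)‖ ^ 2 := by positivity
  unfold gradDev
  linarith

theorem IsBaseLaw.hasMean_gradDev_apply (hν : IsBaseLaw ν) (hell : IsSmooth L ell)
    (w : Param fam d) (i : Fin d) :
    HasMean (base d ν) (fun u => gradDev ν ell w u i) 0 := by
  have := hν.isProb_base d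
  exact ((hν.hasMean_meanGrad_apply hell w (Sum.inl i)).sub
    (HasMean.const (meanGrad ν ell w (Sum.inl i)))).congr (fun u => rfl) (by ring)

theorem IsBaseLaw.hasMean_inner_gradDev (hν : IsBaseLaw ν) (hell : IsSmooth L ell)
    (w : Param fam d) (c : EuclideanSpace ℝ (Fin d)) :
    HasMean (base d ν) (fun u => ⟪c, gradDev ν ell w u⟫) 0 := by
  have h : HasMean (base d ν) (fun u => ∑ i, c i * gradDev ν ell w u i) (∑ i, c i * 0) :=
    HasMean.sum fun i _ => (hν.hasMean_gradDev_apply hell w i).const_mul (c i)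
  refine h.congr (fun u => ?_) (by simp)
  simp [PiLp.inner_apply, mul_comm]

theorem norm_adjReparam_sub_shift_sq (u : Fin d → ℝ) (g c : EuclideanSpace ℝ (Fin d)) :
    ‖(adjReparam u g - shift c : Param fam d)‖ ^ 2
      = ‖g - c‖ ^ 2 + (∑ i, (u i * g i) ^ 2 + ∑ p : OffDiag fam d, (u p.1.2 * g p.1.1) ^ 2) := by
  simp [EuclideanSpace.real_norm_sq_eq]

/-- Total variance of the single-sample reparameterization gradient of `meanEnergy`. -/
noncomputable def reparamVar (ν : Measure ℝ) (ell : EuclideanSpace ℝ (Fin d) → ℝ)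
    (w : Param fam d) : ℝ :=
  ∫ u, ‖adjReparam u (gradient ell (linReparam u w)) - meanGrad ν ell w‖ ^ 2 ∂(base d ν)

/-- Only the location block is centred at its mean; the scale block is bounded by its raw second
moment. -/
theorem IsBaseLaw.reparamVar_le_of_le (hν : IsBaseLaw ν) (hell : IsSmooth L ell) (w : Param fam d)
    {B : (Fin d → ℝ) → ℝ} {b : ℝ} (hB : HasMean (base d ν) B b)
    (h : ∀ u, ‖(adjReparam u (gradient ell (linReparam u w))
      - shift (loc (meanGrad ν ell w)) : Param fam d)‖ ^ 2 ≤ B u) :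
    reparamVar ν ell w ≤ b := by
  have := hν.isProb_base d
  have h1 := (hasMean_norm_sub_sq (hν.memLp_adjReparam hell w)
    (shift (loc (meanGrad ν ell w)))).le hB h
  have h2 := sq_nonneg ‖meanGrad ν ell w - shift (loc (meanGrad ν ell w))‖
  unfold reparamVar
  unfold meanGrad at *
  linarith

/-- Split ∇ℓ = G + D into mean and deviation. The term ‖u‖²‖D‖² is handled by the pointwise bound on
D, and in the cross term ‖u‖² is recentred at d, since ⟪G, D⟫ has mean zero. -/
theorem IsBaseLaw.reparamVar_le_full (hν : IsBaseLaw ν) (hell : IsSmooth L ell)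
    (w : Param fam d) :
    reparamVar ν ell w ≤ 2 * (d + kurtosis ν)
      * (L ^ 2 * ‖centered w‖ ^ 2 + ‖loc (meanGrad ν ell w)‖ ^ 2) := by
  have hk := hν.one_le_kurtosis
  set k := kurtosis ν
  set G := loc (meanGrad ν ell w)
  obtain ⟨σ, hσ, hσm⟩ := hν.hasMean_norm_gradDev_sq hell w
  have hB := ((((hν.hasMean_normSq (d := d)).const_mul (‖G‖ ^ 2)).add
    ((hν.hasMean_normSq_sub_sq (d := d)).const_mul (‖G‖ ^ 2 / k))).add
    (hσm.const_mul (1 + k))).add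
    (((hν.hasMean_inner_gradDev hell w G).const_mul (2 * d)).add
    (((hν.hasMean_normSq_mul_linReparam_centered w).add
      ((hν.hasMean_normSq (d := d)).const_mul (‖centered w‖ ^ 2))).const_mul (L ^ 2)))
  refine (hν.reparamVar_le_of_le hell w hB fun u => ?_).trans ?_
  · rw [norm_adjReparam_sub_shift_sq]
    have h1 := sum_mul_sq_add_sum_offDiag_le (fam := fam) u (gradient ell (linReparam u w))
    have h2 := hν.norm_gradDev_sq_le hell w u
    have hg : gradient ell (linReparam u w) = G + gradDev ν ell w u := by
      simp [gradDev, G]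
    change ‖gradDev ν ell w u‖ ^ 2 + _ ≤ _
    set D := gradDev ν ell w u
    set S := ∑ l, u l ^ 2
    have hS : 0 ≤ S := Finset.sum_nonneg fun _ _ => sq_nonneg _
    have h3 : ‖gradient ell (linReparam u w)‖ ^ 2 = ‖G‖ ^ 2 + 2 * ⟪G, D⟫ + ‖D‖ ^ 2 := by
      rw [hg, norm_add_sq_real]
    rw [h3] at h1
    -- Young's inequality with weight k: (S − d)² has mean d(k − 1), so dividing by k leaves at most
    -- d‖G‖².
    have h4 : 2 * (S - d) * ⟪G, D⟫ ≤ ‖G‖ ^ 2 / k * (S - d) ^ 2 + k * ‖D‖ ^ 2 := by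
      have h5 : (S - d) * ⟪G, D⟫ ≤ |S - d| * (‖G‖ * ‖D‖) := by
        refine (le_abs_self _).trans ?_
        rw [abs_mul]
        gcongr
        exact abs_real_inner_le_norm G D
      have h6 : ‖G‖ ^ 2 / k * (S - d) ^ 2 + k * ‖D‖ ^ 2 - 2 * (|S - d| * (‖G‖ * ‖D‖))
          = (‖G‖ * |S - d| - k * ‖D‖) ^ 2 / k := by
        rw [← sq_abs (S - d)]
        field_simp
        ring
      have h7 : 0 ≤ (‖G‖ * |S - d| - k * ‖D‖) ^ 2 / k := by positivity
      linarith
    have h8 := mul_le_mul_of_nonneg_left h2 hS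
    linarith
  -- The coefficient of L²‖C‖_F² is exactly (1 + k) + (d + k − 1) + d = 2(d + k); that of ‖G‖² is at
  -- most 2d.
  · have h1 : ‖G‖ ^ 2 / k * (d * (k - 1)) ≤ ‖G‖ ^ 2 * d := by
      rw [div_mul_eq_mul_div, div_le_iff₀ (by linarith)]
      have : 0 ≤ ‖G‖ ^ 2 * d := by positivity
      nlinarith
    have h2 : (1 + k) * σ ≤ (1 + k) * (L ^ 2 * ‖centered w‖ ^ 2) := by gcongr
    have h3 : 0 ≤ 2 * k * ‖G‖ ^ 2 := by positivity
    linarith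

/-- With a diagonal scale only u_i² D_i² occurs, so ‖u‖² is replaced by max u_j². Its mean is of
order √d, by bounding the maximum through the sum of fourth powers. -/
theorem IsBaseLaw.reparamVar_le_meanField (hν : IsBaseLaw ν) (hd : 0 < d) (hell : IsSmooth L ell) (w : Param ScaleFamily.meanField d) :
    reparamVar ν ell w ≤ 2 * (2 * kurtosis ν * √(d : ℝ) + 1)
      * (L ^ 2 * ‖centered w‖ ^ 2 + ‖loc (meanGrad ν ell w)‖ ^ 2) := by
  have := hν.isProb_base d
  have : IsEmpty (OffDiag ScaleFamily.meanField d) := ⟨fun p => by simpa using p.2.1⟩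
  have : Nonempty (Fin d) := ⟨⟨0, hd⟩⟩
  have hk := hν.one_le_kurtosis
  set k := kurtosis ν
  set G := loc (meanGrad ν ell w)
  have hβ : 1 ≤ √(d : ℝ) := Real.one_le_sqrt.2 (by exact_mod_cast hd)
  have hββ : √(d : ℝ) * √(d : ℝ) = d := Real.mul_self_sqrt (by positivity)
  set β := √(d : ℝ)
  obtain ⟨σ, hσ, hσm⟩ := hν.hasMean_norm_gradDev_sq hell w
  set c : Fin d → ℝ := fun i => w (Sum.inr (Sum.inl i)) with hc
  have hcw : ‖centered w‖ ^ 2 = ∑ i, c i ^ 2 := by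
    simp [param_norm_sq, centered, loc, hc]
  have hA : ∀ u : Fin d → ℝ, ‖linReparam u (centered w)‖ ^ 2 = ∑ i, c i ^ 2 * u i ^ 2 := by
    intro u
    simp [EuclideanSpace.real_norm_sq_eq, linReparam_apply, centered, loc, hc, mul_pow]
  have hR : HasMean (base d ν) (fun u => 1 / 2 * (1 / β * ∑ j, u j ^ 4 + β))
      (1 / 2 * (1 / β * ∑ _j : Fin d, k + β)) :=
    (((HasMean.sum fun j _ => hν.hasMean_pow_four j).const_mul (1 / β)).add
      (HasMean.const β)).const_mul (1 / 2)
  -- Erasing i keeps u_j⁴ and u_i² independent, so that no sixth moment appears.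
  have hRi : ∀ i, HasMean (base d ν)
      (fun u => 1 / 2 * (1 / β * ∑ j ∈ Finset.univ.erase i, u j ^ 4 * u i ^ 2 + β * u i ^ 2))
      (1 / 2 * (1 / β * ∑ _j ∈ Finset.univ.erase i, k + β * 1)) := fun i =>
    (((HasMean.sum fun j hj => hν.hasMean_pow_four_mul_sq (Finset.ne_of_mem_erase hj)).const_mul
      (1 / β)).add ((hν.hasMean_sq i).const_mul β)).const_mul (1 / 2)
  have h1 : HasMean (base d ν) (fun u => ∑ i, (G i ^ 2 * u i ^ 2
      + G i ^ 2 / k * (u i ^ 2 - 1) ^ 2)) (∑ i, (G i ^ 2 * 1 + G i ^ 2 / k * (k - 1))) :=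
    HasMean.sum fun i _ => ((hν.hasMean_sq i).const_mul _).add
      ((hν.hasMean_sq_sub_one_sq i).const_mul _)
  have h2 := HasMean.sum (s := Finset.univ) fun i _ =>
    (((hν.hasMean_pow_four i).add (hRi i)).add hR).const_mul (c i ^ 2)
  have hB := ((h1.add (hσm.const_mul (1 + k))).add
    ((hν.hasMean_inner_gradDev hell w G).const_mul 2)).add (h2.const_mul (L ^ 2))
  refine (hν.reparamVar_le_of_le hell w hB fun u => ?_).trans ?_
  · rw [norm_adjReparam_sub_shift_sq]
    have hD := hν.norm_gradDev_sq_le hell w u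
    rw [hA, hcw] at hD
    have hg : ∀ i, gradient ell (linReparam u w) i = G i + gradDev ν ell w u i := by
      simp [gradDev, G]
    change ‖gradDev ν ell w u‖ ^ 2 + _ ≤ _
    simp only [hg]
    set D := gradDev ν ell w u
    have hinner : ⟪G, D⟫ = ∑ i, G i * D i := by
      simp [PiLp.inner_apply, mul_comm]
    obtain ⟨m, -, hm⟩ := Finset.exists_max_image Finset.univ (fun i => u i ^ 2)
      Finset.univ_nonempty
    -- The weight β = √d balances the two terms once the fourth powers are summed over d
    -- coordinates.
    have hamgm : ∀ j, u j ^ 2 ≤ 1 / 2 * (1 / β * u j ^ 4 + β) := by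
      intro j
      have : 1 / 2 * (1 / β * u j ^ 4 + β) - u j ^ 2 = (u j ^ 2 - β) ^ 2 / (2 * β) := by
        field_simp
        ring
      have : 0 ≤ (u j ^ 2 - β) ^ 2 / (2 * β) := by positivity
      linarith
    have hmR : u m ^ 2 ≤ 1 / 2 * (1 / β * ∑ j, u j ^ 4 + β) := by
      refine (hamgm m).trans ?_
      gcongr
      exact Finset.single_le_sum (f := fun j => u j ^ 4) (fun j _ => by positivity)
        (Finset.mem_univ m)
    -- Either the maximum is attained at i, giving u_i⁴, or at another index, which the erased sum
    -- covers.
    have hmRi : ∀ i, u m ^ 2 * u i ^ 2 ≤ u i ^ 4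
        + 1 / 2 * (1 / β * ∑ j ∈ Finset.univ.erase i, u j ^ 4 * u i ^ 2 + β * u i ^ 2) := by
      intro i
      rw [← Finset.sum_mul]
      have hs : 0 ≤ ∑ j ∈ Finset.univ.erase i, u j ^ 4 :=
        Finset.sum_nonneg fun _ _ => by positivity
      by_cases hmi : m = i
      · subst hmi
        have : 0 ≤ 1 / 2 * (1 / β * ((∑ j ∈ Finset.univ.erase m, u j ^ 4) * u m ^ 2)
          + β * u m ^ 2) := by positivity
        nlinarith
      · have h3 : u m ^ 2 ≤ 1 / 2 * (1 / β * ∑ j ∈ Finset.univ.erase i, u j ^ 4 + β) := by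
          refine (hamgm m).trans ?_
          gcongr
          exact Finset.single_le_sum (f := fun j => u j ^ 4) (fun j _ => by positivity)
            (Finset.mem_erase.2 ⟨hmi, Finset.mem_univ m⟩)
        have h4 := mul_le_mul_of_nonneg_right h3 (sq_nonneg (u i))
        have : 0 ≤ u i ^ 4 := by positivity
        linarith
    have hlast : ∑ i, u i ^ 2 * D i ^ 2 ≤ L ^ 2 * ∑ i, c i ^ 2 * (u i ^ 4
        + 1 / 2 * (1 / β * ∑ j ∈ Finset.univ.erase i, u j ^ 4 * u i ^ 2 + β * u i ^ 2)
        + 1 / 2 * (1 / β * ∑ j, u j ^ 4 + β)) := by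
      calc ∑ i, u i ^ 2 * D i ^ 2 ≤ ∑ i, u m ^ 2 * D i ^ 2 :=
            Finset.sum_le_sum fun i hi => mul_le_mul_of_nonneg_right (hm i hi) (sq_nonneg _)
        _ = u m ^ 2 * ‖D‖ ^ 2 := by rw [← Finset.mul_sum, EuclideanSpace.real_norm_sq_eq]
        _ ≤ u m ^ 2 * (L ^ 2 * (∑ i, c i ^ 2 * u i ^ 2 + ∑ i, c i ^ 2)) := by gcongr
        _ = L ^ 2 * ∑ i, c i ^ 2 * (u m ^ 2 * u i ^ 2 + u m ^ 2) := by
            simp only [mul_add, Finset.sum_add_distrib, Finset.mul_sum]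
            congr 1 <;> exact Finset.sum_congr rfl fun i _ => by ring
        _ ≤ _ := by
            gcongr with i _
            exact hmRi i
    have hmain : ∑ i, (u i * (G i + D i)) ^ 2 ≤ ∑ i, (G i ^ 2 * u i ^ 2
        + G i ^ 2 / k * (u i ^ 2 - 1) ^ 2) + k * ‖D‖ ^ 2 + 2 * ⟪G, D⟫
        + ∑ i, u i ^ 2 * D i ^ 2 := by
      rw [hinner, EuclideanSpace.real_norm_sq_eq, Finset.mul_sum, Finset.mul_sum,
        ← Finset.sum_add_distrib, ← Finset.sum_add_distrib, ← Finset.sum_add_distrib]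
      refine Finset.sum_le_sum fun i _ => ?_
      have h6 : G i ^ 2 / k * (u i ^ 2 - 1) ^ 2 + k * D i ^ 2 - 2 * ((u i ^ 2 - 1) * (G i * D i))
          = (G i * (u i ^ 2 - 1) - k * D i) ^ 2 / k := by
        field_simp
        ring
      have h7 : 0 ≤ (G i * (u i ^ 2 - 1) - k * D i) ^ 2 / k := by positivity
      nlinarith
    simp only [Finset.univ_eq_empty, Finset.sum_empty, add_zero]
    linarith
  · have hx : ∑ i, (G i ^ 2 * 1 + G i ^ 2 / k * (k - 1)) ≤ 2 * ‖G‖ ^ 2 := by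
      rw [EuclideanSpace.real_norm_sq_eq, Finset.mul_sum]
      refine Finset.sum_le_sum fun i _ => ?_
      have : G i ^ 2 / k * (k - 1) ≤ G i ^ 2 := by
        rw [div_mul_eq_mul_div, div_le_iff₀ (by linarith)]
        nlinarith [sq_nonneg (G i)]
      linarith
    have hdβ : 1 / β * (d * k) = β * k := by
      rw [← hββ]
      field_simp
    have hy : ∑ i, c i ^ 2 * (k + 1 / 2 * (1 / β * ∑ _j ∈ Finset.univ.erase i, k + β * 1)
        + 1 / 2 * (1 / β * ∑ _j : Fin d, k + β)) ≤ (k + 2 * k * β) * ‖centered w‖ ^ 2 := by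
      rw [hcw, Finset.mul_sum Finset.univ fun i => c i ^ 2]
      refine Finset.sum_le_sum fun i _ => ?_
      rw [mul_comm]
      refine mul_le_mul_of_nonneg_right ?_ (sq_nonneg (c i))
      have e1 : ∑ _j ∈ Finset.univ.erase i, k ≤ d * k := by
        rw [Finset.sum_const, nsmul_eq_mul]
        have hcard : ((Finset.univ.erase i).card : ℝ) ≤ d := by
          exact_mod_cast (Finset.card_le_univ (Finset.univ.erase i)).trans (by simp)
        exact mul_le_mul_of_nonneg_right hcard (by linarith)
      have e2 : 1 / β * ∑ _j ∈ Finset.univ.erase i, k ≤ β * k := by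
        rw [← hdβ]
        gcongr
      have e3 : 1 / β * ∑ _j : Fin d, k = β * k := by
        rw [← hdβ]
        simp
      rw [e3]
      nlinarith
    have h3 := mul_le_mul_of_nonneg_left hy (sq_nonneg L)
    have h4 : (1 + k) * σ ≤ (1 + k) * (L ^ 2 * ‖centered w‖ ^ 2) := by gcongr
    have h5 : 0 ≤ 2 * (2 * k * β) * ‖G‖ ^ 2 := by positivity
    -- The slack between the claimed 4kβ + 2 and the obtained (1 + k) + (k + 2kβ), nonnegative since
    -- β ≥ 1.
    have h6 : 0 ≤ (2 * k * (β - 1) + 1) * (L ^ 2 * ‖centered w‖ ^ 2) := by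
      have : 0 ≤ β - 1 := by linarith
      positivity
    nlinarith

theorem IsBaseLaw.dimConst_nonneg (hν : IsBaseLaw ν) (fam : ScaleFamily) (d : ℕ) :
    0 ≤ dimConst fam d ν := by
  have hk := hν.one_le_kurtosis
  have : 0 ≤ kurtosis ν := by linarith
  cases fam <;> simp only [dimConst] <;> positivity

theorem IsBaseLaw.reparamVar_le (hν : IsBaseLaw ν) (hell : IsSmooth L ell)
    (w : Param fam d) :
    reparamVar ν ell w ≤ 2 * dimConst fam d ν
      * (L ^ 2 * ‖centered w‖ ^ 2 + ‖loc (meanGrad ν ell w)‖ ^ 2) := by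
  rcases Nat.eq_zero_or_pos d with rfl | hd
  · have : IsEmpty (OffDiag fam 0) := ⟨fun p => p.1.1.elim0⟩
    have h : reparamVar ν ell w = 0 := by
      simp [reparamVar, param_norm_sq]
    rw [h]
    have := hν.dimConst_nonneg fam 0
    positivity
  · cases fam
    · exact hν.reparamVar_le_meanField hd hell w
    · exact hν.reparamVar_le_full hell w

end BBVI

namespace BBVI

open Filter Topology
open scoped RealInnerProductSpace

variable {fam : ScaleFamily} {d : ℕ}

/-! ### Smoothness of the negative ELBO -/

variable {ν : Measure ℝ} {φ : ℝ → ℝ} {ell : EuclideanSpace ℝ (Fin d) → ℝ} {L Lφ Ls : ℝ}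

/-- The gradient of `negElbo`. -/
noncomputable def elboGrad (ν : Measure ℝ) (φ : ℝ → ℝ) (ell : EuclideanSpace ℝ (Fin d) → ℝ)
    (lam : Param fam d) : Param fam d :=
  condDeriv φ lam (meanGrad ν ell (condMap φ lam)) + entropyGrad φ lam

theorem _root_.HasGradientAt.add' {V : Type*} [NormedAddCommGroup V] [InnerProductSpace ℝ V]
    [CompleteSpace V] {f g : V → ℝ} {a b x : V} (hf : HasGradientAt f a x)
    (hg : HasGradientAt g b x) : HasGradientAt (fun y => f y + g y) (a + b) x := by
  rw [hasGradientAt_iff_hasFDerivAt, map_add]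
  exact hf.hasFDerivAt.add hg.hasFDerivAt

theorem IsBaseLaw.hasGradientAt_negElbo (hν : IsBaseLaw ν) (hLφ : 0 ≤ Lφ)
    (hφ : IsConditioner φ Lφ) (hell : IsSmooth L ell) (lam : Param fam d) :
    HasGradientAt (negElbo ν φ ell) (elboGrad ν φ ell lam) lam :=
  (hν.hasGradientAt_energy hφ.differentiable hell lam).add'
    (hν.hasGradientAt_negEntropy hLφ hφ lam)

theorem IsBaseLaw.continuous_negElbo (hν : IsBaseLaw ν) (hLφ : 0 ≤ Lφ)
    (hφ : IsConditioner φ Lφ) (hell : IsSmooth L ell) :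
    Continuous (negElbo ν φ ell : Param fam d → ℝ) :=
  continuous_iff_continuousAt.2 fun lam => (hν.hasGradientAt_negElbo hLφ hφ hell lam).continuousAt

theorem IsBaseLaw.continuous_elboGrad (hν : IsBaseLaw ν) (hL : 0 ≤ L)
    (hφ : IsConditioner φ Lφ) (hell : IsSmooth L ell) :
    Continuous (elboGrad ν φ ell : Param fam d → Param fam d) := by
  have h1 : Continuous fun lam : Param fam d => (lam, meanGrad ν ell (condMap φ lam)) :=
    continuous_id.prodMk ((hν.continuous_meanGrad hL hell).comp
      (continuous_condMap hφ.differentiable.continuous))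
  exact ((continuous_condDeriv_apply hφ.continuous_deriv).comp h1).add (continuous_entropyGrad hφ)

theorem IsBaseLaw.negElbo_le_add (hν : IsBaseLaw ν) (hL : 0 ≤ L) (hLφ : 0 ≤ Lφ) (hLs : 0 ≤ Ls)
    (hφ : IsConditioner φ Lφ) (hell : IsSmooth L ell) (hgrad : ReparamGradientBound fam ν φ ell Ls)
    (lam v : Param fam d) :
    negElbo ν φ ell (lam + v) ≤ negElbo ν φ ell lam + ⟪elboGrad ν φ ell lam, v⟫
      + (L + Lφ + Ls) / 2 * ‖v‖ ^ 2 := by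
  have h1 := hν.energy_le_add hL hell hφ hLs hgrad lam v
  have h2 := (abs_le.1 (hν.abs_negEntropy_sub_le hLφ hφ lam v)).2
  simp only [negElbo, elboGrad, inner_add_left]
  linarith

/-- A smooth function bounded below has gradient controlled by its suboptimality. -/
theorem norm_sq_le_of_descent {V : Type*} [NormedAddCommGroup V] [InnerProductSpace ℝ V]
    {F : V → ℝ} {x g : V} {K m : ℝ} (hK : 0 < K)
    (h : ∀ v, F (x + v) ≤ F x + ⟪g, v⟫ + K / 2 * ‖v‖ ^ 2) (hm : ∀ y, m ≤ F y) :
    ‖g‖ ^ 2 ≤ 2 * K * (F x - m) := by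
  -- The vector −g/K minimizes the quadratic upper model.
  have h1 := (hm _).trans (h (-(1 / K) • g))
  rw [inner_smul_right, real_inner_self_eq_norm_sq, norm_smul, mul_pow, Real.norm_eq_abs, sq_abs]
    at h1
  have h2 : F x + -(1 / K) * ‖g‖ ^ 2 + K / 2 * ((-(1 / K)) ^ 2 * ‖g‖ ^ 2)
      = F x - ‖g‖ ^ 2 / (2 * K) := by
    field_simp
    ring
  rw [h2] at h1
  have h3 : ‖g‖ ^ 2 / (2 * K) ≤ F x - m := by linarith
  rw [div_le_iff₀ (by positivity)] at h3
  linarith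

/-- A pure translation leaves the entropy unchanged and commutes with the conditioner, so only the
energy moves and the constant is L rather than L_F. -/
theorem IsBaseLaw.norm_loc_meanGrad_sq_le (hν : IsBaseLaw ν) (hL : 0 < L)
    (hφ : IsConditioner φ Lφ) (hell : IsSmooth L ell) {m : ℝ}
    (hm : ∀ l : Param fam d, m ≤ negElbo ν φ ell l) (lam : Param fam d) :
    ‖loc (meanGrad ν ell (condMap φ lam))‖ ^ 2 ≤ 2 * L * (negElbo ν φ ell lam - m) := by
  have := norm_sq_le_of_descent (F := fun b => negElbo ν φ ell (lam + shift b)) (x := 0)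
    (g := loc (meanGrad ν ell (condMap φ lam))) hL (fun b => ?_) fun b => hm _
  · have h0 : (shift 0 : Param fam d) = 0 := by
      ext (i | i) <;> simp
    simpa [h0] using this
  · have h0 : (shift 0 : Param fam d) = 0 := by
      ext (i | i) <;> simp
    have h1 := (abs_le.1 (hν.abs_meanEnergy_sub_le hell (condMap φ lam) (shift b))).2
    rw [inner_shift, norm_shift_sq] at h1
    simp only [negElbo, zero_add, h0, add_zero, hν.negEntropy_add_shift hφ,
      energy_eq φ hell.1.continuous, condMap_add_shift]
    linarith

/-! ### The stochastic gradient step -/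

/-- The single-sample reparameterization gradient. -/
noncomputable def sampleGrad (φ : ℝ → ℝ) (ell : EuclideanSpace ℝ (Fin d) → ℝ) (lam : Param fam d)
    (u : Fin d → ℝ) : Param fam d :=
  condDeriv φ lam (adjReparam u (gradient ell (linReparam u (condMap φ lam))))

theorem gradient_comp_reparam (hφ : Differentiable ℝ φ) (hell : IsSmooth L ell) (u : Fin d → ℝ)
    (lam : Param fam d) :
    gradient (fun l : Param fam d => ell (reparam φ l u)) lam = sampleGrad φ ell lam u := by
  simp only [reparam_eq]
  refine HasGradientAt.gradient (hasGradientAt_comp_condMap (f := fun w => ell (linReparam u w))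
    hφ ?_)
  rw [hasGradientAt_iff_hasFDerivAt]
  refine ((hell.hasGradientAt _).hasFDerivAt.comp _
    (linReparam u : Param fam d →L[ℝ] _).hasFDerivAt).congr_fderiv ?_
  ext v
  simp only [ContinuousLinearMap.comp_apply, InnerProductSpace.toDual_apply_apply]
  rw [real_inner_comm, inner_linReparam, real_inner_comm]

theorem continuous_sampleGrad (hφ : IsConditioner φ Lφ) (hell : IsSmooth L ell) :
    Continuous fun q : Param fam d × (Fin d → ℝ) => sampleGrad φ ell q.1 q.2 := by
  have h1 : Continuous fun q : Param fam d × (Fin d → ℝ) => (q.2, condMap φ q.1) :=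
    continuous_snd.prodMk ((continuous_condMap hφ.differentiable.continuous).comp continuous_fst)
  have h2 := (continuous_adjReparam_gradient (fam := fam) hell).comp h1
  have h3 := (continuous_fst (X := Param fam d) (Y := Fin d → ℝ)).prodMk h2
  exact (continuous_condDeriv_apply hφ.continuous_deriv).comp h3

theorem IsBaseLaw.memLp_sampleGrad (hν : IsBaseLaw ν) (φ : ℝ → ℝ) (hell : IsSmooth L ell)
    (lam : Param fam d) : MemLp (sampleGrad φ ell lam) 2 (base d ν) :=
  (condDeriv φ lam).comp_memLp' (hν.memLp_adjReparam hell (condMap φ lam))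

theorem IsBaseLaw.integral_sampleGrad (hν : IsBaseLaw ν) (φ : ℝ → ℝ) (hell : IsSmooth L ell)
    (lam : Param fam d) :
    ∫ u, sampleGrad φ ell lam u ∂(base d ν) = condDeriv φ lam (meanGrad ν ell (condMap φ lam)) :=
  (condDeriv φ lam).integral_comp_comm (hν.integrable_adjReparam hell (condMap φ lam))

theorem IsBaseLaw.integral_norm_sampleGrad_sub_sq_le (hν : IsBaseLaw ν) (hφ : IsConditioner φ Lφ)
    (hell : IsSmooth L ell) (lam : Param fam d) :
    ∫ u, ‖sampleGrad φ ell lam u - condDeriv φ lam (meanGrad ν ell (condMap φ lam))‖ ^ 2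
      ∂(base d ν) ≤ reparamVar ν ell (condMap φ lam) := by
  have := hν.isProb_base d
  refine integral_mono ?_ ?_ fun u => ?_
  · exact ((hν.memLp_sampleGrad φ hell lam).sub (memLp_const _)).integrable_norm_pow two_ne_zero
  · exact ((hν.memLp_adjReparam hell _).sub (memLp_const _)).integrable_norm_pow two_ne_zero
  · simp only [sampleGrad, ← map_sub]
    exact pow_le_pow_left₀ (norm_nonneg _) (norm_condDeriv_le hφ _ _) 2

theorem HasMean.comp_eval {ι α : Type*} [Fintype ι] [MeasurableSpace α] {ρ : Measure α}
    [IsProbabilityMeasure ρ] {f : α → ℝ} {c : ℝ} (hf : HasMean ρ f c) (i : ι) :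
    HasMean (Measure.pi fun _ : ι => ρ) (fun v => f (v i)) c := by
  have hmp := measurePreserving_eval (fun _ : ι => ρ) i
  have h := integral_map (f := f) hmp.measurable.aemeasurable
    (by rw [hmp.map_eq]; exact hf.1.aestronglyMeasurable)
  rw [hmp.map_eq] at h
  exact ⟨hmp.integrable_comp_of_integrable hf.1, h.symm.trans hf.2⟩

/-- Second moment of a sum of i.i.d. centered vectors. -/
theorem hasMean_norm_sum_sq_pi {ι κ α : Type*} [Fintype ι] [Fintype κ] [MeasurableSpace α]
    {ρ : Measure α} [IsProbabilityMeasure ρ] {Z : α → EuclideanSpace ℝ κ} (hZ : MemLp Z 2 ρ)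
    (h0 : ∫ x, Z x ∂ρ = 0) :
    HasMean (Measure.pi fun _ : ι => ρ) (fun v => ‖∑ i, Z (v i)‖ ^ 2)
      (Fintype.card ι * ∫ x, ‖Z x‖ ^ 2 ∂ρ) := by
  have hi := hZ.integrable one_le_two
  have hc : ∀ c, MemLp (fun x => Z x c) 2 ρ := fun c =>
    (EuclideanSpace.proj c : EuclideanSpace ℝ κ →L[ℝ] ℝ).comp_memLp' hZ
  have hc0 : ∀ c, ∫ x, Z x c ∂ρ = 0 := fun c => by
    have := (EuclideanSpace.proj c : EuclideanSpace ℝ κ →L[ℝ] ℝ).integral_comp_comm hi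
    rw [h0] at this
    simpa using this
  have hmp : ∀ i, MeasurePreserving (Function.eval i) (Measure.pi fun _ : ι => ρ) ρ :=
    measurePreserving_eval fun _ : ι => ρ
  have hs : ∀ c, HasMean (Measure.pi fun _ : ι => ρ) (fun v => (∑ i, Z (v i) c) ^ 2)
      (Fintype.card ι * ∫ x, Z x c ^ 2 ∂ρ) := by
    intro c
    have hci : ∀ i, MemLp (fun v : ι → α => Z (v i) c) 2 (Measure.pi fun _ : ι => ρ) := fun i =>
      (hc c).comp_measurePreserving (hmp i)
    have hsum : MemLp (fun v : ι → α => ∑ i, Z (v i) c) 2 (Measure.pi fun _ : ι => ρ) :=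
      memLp_finsetSum _ fun i _ => hci i
    refine ⟨hsum.integrable_sq, ?_⟩
    have hmean : ∫ v, ∑ i, Z (v i) c ∂(Measure.pi fun _ : ι => ρ) = 0 := by
      rw [integral_finsetSum _ fun i _ => (hci i).integrable one_le_two]
      exact Finset.sum_eq_zero fun i _ =>
        (HasMean.comp_eval (f := fun x => Z x c) ⟨(hc c).integrable one_le_two, hc0 c⟩ i).2
    -- Coordinatewise, variances of independent summands add, which produces the factor 1/M after
    -- averaging.
    have hv := variance_sum_pi (μ := fun _ : ι => ρ) (X := fun _ x => Z x c) fun _ => hc c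
    rw [variance_of_integral_eq_zero (hc c).aestronglyMeasurable.aemeasurable (hc0 c)] at hv
    rw [show (∑ i, fun ω : ι → α => Z (ω i) c) = fun v => ∑ i, Z (v i) c by ext; simp,
      variance_of_integral_eq_zero hsum.aestronglyMeasurable.aemeasurable hmean] at hv
    simpa using hv
  refine (HasMean.sum (s := Finset.univ) fun c _ => hs c).congr (fun v => ?_) ?_
  · rw [EuclideanSpace.real_norm_sq_eq]
    simp
  · simp only [EuclideanSpace.real_norm_sq_eq]
    rw [integral_finsetSum _ fun c _ => (hc c).integrable_sq, Finset.mul_sum]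

/-- The stochastic gradient step. -/
noncomputable def sgdStep {M : ℕ} (φ : ℝ → ℝ) (ell : EuclideanSpace ℝ (Fin d) → ℝ) (γ : ℝ)
    (lam : Param fam d) (v : Fin M → Fin d → ℝ) : Param fam d :=
  lam - γ • ((1 / (M : ℝ)) • ∑ m, sampleGrad φ ell lam (v m) + entropyGrad φ lam)

theorem continuous_sgdStep {M : ℕ} (hφ : IsConditioner φ Lφ) (hell : IsSmooth L ell) (γ : ℝ) :
    Continuous fun q : Param fam d × (Fin M → Fin d → ℝ) => sgdStep φ ell γ q.1 q.2 := by
  have h1 : Continuous fun q : Param fam d × (Fin M → Fin d → ℝ) =>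
      ∑ m, sampleGrad φ ell q.1 (q.2 m) := by
    refine continuous_finsetSum _ fun m _ => ?_
    have h2 : Continuous fun q : Param fam d × (Fin M → Fin d → ℝ) => (q.1, q.2 m) := by fun_prop
    have h3 := (continuous_sampleGrad (fam := fam) hφ hell).comp h2
    exact h3
  have h2 : Continuous fun q : Param fam d × (Fin M → Fin d → ℝ) => q.1 := continuous_fst
  have h3 := (continuous_entropyGrad (fam := fam) (d := d) hφ).comp h2
  exact h2.sub (((h1.const_smul (1 / (M : ℝ))).add h3).const_smul γ)

/-- Expected descent of one stochastic gradient step. -/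
theorem IsBaseLaw.integral_negElbo_sgdStep_le {M : ℕ} (hM : 0 < M) (hν : IsBaseLaw ν) (hL : 0 < L)
    (hLφ : 0 ≤ Lφ) (hLs : 0 ≤ Ls) (hφ : IsConditioner φ Lφ) (hell : IsSmooth L ell)
    (hgrad : ReparamGradientBound fam ν φ ell Ls) {m : ℝ}
    (hm : ∀ l : Param fam d, m ≤ negElbo ν φ ell l) {γ : ℝ} (hγ : 0 < γ)
    (hγF : γ < 1 / (L + Lφ + Ls)) (lam : Param fam d) :
    Integrable (fun v : Fin M → Fin d → ℝ => negElbo ν φ ell (sgdStep φ ell γ lam v))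
      (Measure.pi fun _ => base d ν) ∧
    ∫ v : Fin M → Fin d → ℝ, negElbo ν φ ell (sgdStep φ ell γ lam v)
      ∂(Measure.pi fun _ => base d ν) ≤ negElbo ν φ ell lam - γ / 2 * ‖elboGrad ν φ ell lam‖ ^ 2
        + γ ^ 2 * (L + Lφ + Ls) / (2 * M) * reparamVar ν ell (condMap φ lam) := by
  have := hν.isProb_base d
  have hM' : (0 : ℝ) < M := by exact_mod_cast hM
  set K := L + Lφ + Ls with hK
  have hK0 : 0 < K := by positivity
  have hγK : γ * K < 1 := by rwa [lt_div_iff₀ hK0] at hγF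
  set Q := Measure.pi fun _ : Fin M => base d ν
  set g := elboGrad ν φ ell lam with hg
  set e := condDeriv φ lam (meanGrad ν ell (condMap φ lam)) with he
  set Z : (Fin d → ℝ) → Param fam d := fun u => sampleGrad φ ell lam u - e with hZ
  have hZm : MemLp Z 2 (base d ν) := (hν.memLp_sampleGrad φ hell lam).sub (memLp_const e)
  have hZ0 : ∫ u, Z u ∂(base d ν) = 0 := by
    rw [integral_sub ((hν.memLp_sampleGrad φ hell lam).integrable one_le_two)
      (integrable_const e), hν.integral_sampleGrad φ hell]
    simp [he]
  have hN2 : HasMean Q (fun v => ‖∑ i, Z (v i)‖ ^ 2) (M * ∫ u, ‖Z u‖ ^ 2 ∂(base d ν)) := by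
    simpa using hasMean_norm_sum_sq_pi (ι := Fin M) hZm hZ0
  have hN1 : HasMean Q (fun v => ⟪g, ∑ i, Z (v i)⟫) 0 := by
    have h1 : ∀ i : Fin M, HasMean Q (fun v => ⟪g, Z (v i)⟫) 0 := by
      intro i
      have h2 : HasMean (base d ν) (fun u => ⟪g, Z u⟫) 0 := by
        have hi := hZm.integrable one_le_two
        refine ⟨hi.const_inner g, ?_⟩
        rw [integral_inner hi, hZ0, inner_zero_right]
      exact h2.comp_eval i
    refine (HasMean.sum (s := Finset.univ) fun i _ => h1 i).congr (fun v => ?_) (by simp)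
    rw [inner_sum]
  have hstep : ∀ v : Fin M → Fin d → ℝ, sgdStep φ ell γ lam v
      = lam + (-γ) • (g + (1 / (M : ℝ)) • ∑ i, Z (v i)) := by
    intro v
    have h1 : (1 / (M : ℝ)) • ∑ i, Z (v i)
        = (1 / (M : ℝ)) • ∑ i, sampleGrad φ ell lam (v i) - e := by
      simp only [hZ, Finset.sum_sub_distrib, Finset.sum_const, Finset.card_univ,
        Fintype.card_fin, smul_sub, ← Nat.cast_smul_eq_nsmul ℝ, smul_smul]
      rw [one_div_mul_cancel hM'.ne', one_smul]
    rw [h1, hg, elboGrad, ← he, sgdStep, neg_smul, ← sub_eq_add_neg]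
    congr 2
    abel
  have hB := ((HasMean.const (ρ := Q) (negElbo ν φ ell lam - γ * (1 - K / 2 * γ) * ‖g‖ ^ 2)).add
    (hN1.const_mul ((K * γ ^ 2 - γ) * (1 / M)))).add
    (hN2.const_mul (K / 2 * γ ^ 2 * (1 / M) ^ 2))
  have hle : ∀ v : Fin M → Fin d → ℝ, negElbo ν φ ell (sgdStep φ ell γ lam v)
      ≤ negElbo ν φ ell lam - γ * (1 - K / 2 * γ) * ‖g‖ ^ 2
        + (K * γ ^ 2 - γ) * (1 / M) * ⟪g, ∑ i, Z (v i)⟫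
        + K / 2 * γ ^ 2 * (1 / M) ^ 2 * ‖∑ i, Z (v i)‖ ^ 2 := by
    intro v
    rw [hstep]
    refine (hν.negElbo_le_add hL.le hLφ hLs hφ hell hgrad lam _).trans (le_of_eq ?_)
    rw [norm_smul, mul_pow, norm_add_sq_real, norm_smul, inner_smul_right, inner_smul_right,
      inner_add_right, inner_smul_right, real_inner_self_eq_norm_sq, ← hg, ← hK,
      Real.norm_eq_abs, Real.norm_eq_abs, mul_pow, sq_abs, sq_abs]
    ring
  have hmeas : AEStronglyMeasurable
      (fun v : Fin M → Fin d → ℝ => negElbo ν φ ell (sgdStep φ ell γ lam v)) Q := by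
    have h1 : Continuous fun v : Fin M → Fin d → ℝ => (lam, v) := by fun_prop
    exact ((hν.continuous_negElbo hLφ hφ hell).comp
      ((continuous_sgdStep hφ hell γ).comp h1)).aestronglyMeasurable
  have hint : Integrable (fun v : Fin M → Fin d → ℝ => negElbo ν φ ell (sgdStep φ ell γ lam v))
      Q := by
    -- Two-sided domination: the descent bound from above, the lower bound m from below.
    refine (hB.1.abs.add (integrable_const |m|)).mono' hmeas (Eventually.of_forall fun v => ?_)
    simp only [Pi.add_apply]
    rw [Real.norm_eq_abs, abs_le]
    have h1 := hm (sgdStep φ ell γ lam v)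
    have h2 := neg_abs_le m
    have h3 := (hle v).trans (le_abs_self _)
    refine ⟨?_, ?_⟩
    · refine le_trans ?_ (h2.trans h1)
      rw [neg_le_neg_iff]
      exact le_add_of_nonneg_left (abs_nonneg _)
    · exact h3.trans (le_add_of_nonneg_right (abs_nonneg _))
  refine ⟨hint, (hint.hasMean.le hB hle).trans ?_⟩
  have hV := hν.integral_norm_sampleGrad_sub_sq_le hφ hell lam
  have h1 : K / 2 * γ ^ 2 * (1 / M) ^ 2 * (M * ∫ u, ‖Z u‖ ^ 2 ∂(base d ν))
      = γ ^ 2 * K / (2 * M) * ∫ u, ‖Z u‖ ^ 2 ∂(base d ν) := by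
    field_simp
  rw [h1]
  have h2 : γ ^ 2 * K / (2 * M) * ∫ u, ‖Z u‖ ^ 2 ∂(base d ν)
      ≤ γ ^ 2 * K / (2 * M) * reparamVar ν ell (condMap φ lam) := by gcongr
  -- The stepsize condition γK < 1 makes the bracket at least 1/2.
  have h3 : γ / 2 * ‖g‖ ^ 2 ≤ γ * (1 - K / 2 * γ) * ‖g‖ ^ 2 := by
    gcongr
    nlinarith
  linarith

/-! ### The SGD iterates -/

section Iterates

variable {M : ℕ} {γ : ℝ} {lam0 : Param fam d}

theorem IsBaseLaw.sgd_succ (hν : IsBaseLaw ν) (hLφ : 0 ≤ Lφ) (hφ : IsConditioner φ Lφ)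
    (hell : IsSmooth L ell) (u : ℕ → Fin M → Fin d → ℝ) (t : ℕ) :
    sgd ν φ ell γ lam0 u (t + 1) = sgdStep φ ell γ (sgd ν φ ell γ lam0 u t) (u t) := by
  simp only [sgd, sgdStep, gradEst, gradient_comp_reparam hφ.differentiable hell,
    (hν.hasGradientAt_negEntropy hLφ hφ _).gradient]

theorem sgd_congr {u u' : ℕ → Fin M → Fin d → ℝ} {t : ℕ} (h : ∀ t' < t, u t' = u' t') :
    sgd ν φ ell γ lam0 u t = sgd ν φ ell γ lam0 u' t := by
  induction t with
  | zero => rfl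
  | succ t ih =>
    simp only [sgd]
    rw [ih fun t' ht' => h t' (ht'.trans t.lt_succ_self), h t t.lt_succ_self]

theorem IsBaseLaw.measurable_sgd {Ω : Type*} [MeasurableSpace Ω] (hν : IsBaseLaw ν) (hLφ : 0 ≤ Lφ)
    (hφ : IsConditioner φ Lφ) (hell : IsSmooth L ell) {u : ℕ → Fin M → Ω → Fin d → ℝ}
    (hu : ∀ t m, Measurable (u t m)) (t : ℕ) :
    Measurable fun ω => sgd ν φ ell γ lam0 (fun t' m => u t' m ω) t := by
  induction t with
  | zero => exact measurable_const
  | succ t ih =>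
    simp only [hν.sgd_succ hLφ hφ hell]
    exact (continuous_sgdStep hφ hell γ).measurable.comp
      (ih.prodMk (measurable_pi_lambda _ fun m => hu t m))

/-- The iterate at time t is a measurable function of the samples with time index below t, a block
disjoint from those used at step t. -/
theorem IsBaseLaw.indepFun_sgd {Ω : Type*} [MeasurableSpace Ω] {P : Measure Ω}
    (hν : IsBaseLaw ν) (hLφ : 0 ≤ Lφ) (hφ : IsConditioner φ Lφ) (hell : IsSmooth L ell)
    {u : ℕ → Fin M → Ω → Fin d → ℝ} (hu : ∀ t m, Measurable (u t m))
    (hu_indep : iIndepFun (fun p : ℕ × Fin M => u p.1 p.2) P) (t : ℕ) :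
    IndepFun (fun ω => sgd ν φ ell γ lam0 (fun t' m => u t' m ω) t) (fun ω m => u t m ω) P := by
  classical
  set S : Finset (ℕ × Fin M) := Finset.range t ×ˢ Finset.univ with hS
  set S' : Finset (ℕ × Fin M) := {t} ×ˢ Finset.univ with hS'
  have hdisj : Disjoint S S' := by
    rw [Finset.disjoint_left]
    rintro ⟨a, b⟩ h1 h2
    simp only [hS, hS', Finset.mem_product, Finset.mem_range, Finset.mem_singleton] at h1 h2
    omega
  have h := hu_indep.indepFun_finset S S' hdisj fun p => hu p.1 p.2
  -- The default 0 is harmless: by `sgd_congr` later samples do not affect the iterate at time t.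
  let ext : (S → Fin d → ℝ) → ℕ → Fin M → Fin d → ℝ := fun v t' m =>
    if h : (t', m) ∈ S then v ⟨(t', m), h⟩ else 0
  have hG : Measurable fun v : S → Fin d → ℝ => sgd ν φ ell γ lam0 (ext v) t := by
    refine hν.measurable_sgd (u := fun t' m v => ext v t' m) hLφ hφ hell (fun t' m => ?_) t
    by_cases h : (t', m) ∈ S
    · simp only [ext, h, dif_pos]
      exact measurable_pi_apply _
    · simp only [ext, h, dif_neg, not_false_eq_true]
      exact measurable_const
  have hH : Measurable fun (v : S' → Fin d → ℝ) (m : Fin M) => v ⟨(t, m), by simp [hS']⟩ :=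
    measurable_pi_lambda _ fun m => measurable_pi_apply _
  have h2 := h.comp hG hH
  convert h2 using 1
  · ext1 ω
    refine sgd_congr fun t' ht' => ?_
    ext1 m
    have : (t', m) ∈ S := by simp [hS, ht']
    simp [ext, this]
  · rfl

theorem map_samples_eq_pi {Ω : Type*} [MeasurableSpace Ω] {P : Measure Ω} [IsProbabilityMeasure P]
    {u : ℕ → Fin M → Ω → Fin d → ℝ} (hu : ∀ t m, Measurable (u t m))
    (hu_indep : iIndepFun (fun p : ℕ × Fin M => u p.1 p.2) P)
    (hu_law : ∀ t m, P.map (u t m) = base d ν) (t : ℕ) :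
    P.map (fun ω m => u t m ω) = Measure.pi fun _ => base d ν := by
  have h : iIndepFun (fun m => u t m) P :=
    hu_indep.precomp (g := fun m : Fin M => (t, m)) fun a b hab => by simpa using hab
  rw [(iIndepFun_iff_map_fun_eq_pi_map fun m => (hu t m).aemeasurable).1 h]
  simp only [hu_law]

end Iterates

/-! ### Conditioning on the past and telescoping -/

/-- Integration of a function of two independent variables, first over the second one. -/
theorem _root_.ProbabilityTheory.IndepFun.integral_le_of_integral_le {Ω X Y : Type*}
    [MeasurableSpace Ω] [MeasurableSpace X] [MeasurableSpace Y] {P : Measure Ω}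
    [IsProbabilityMeasure P] {ρ : Measure Y} [IsProbabilityMeasure ρ] {f : Ω → X} {g : Ω → Y}
    (hind : IndepFun f g P) (hf : Measurable f) (hg : Measurable g) (hlaw : P.map g = ρ)
    {Φ : X × Y → ℝ} (hΦ : Measurable Φ) {c : ℝ} (hc : ∀ q, c ≤ Φ q) {B : X → ℝ}
    (hB : Measurable B) (hBint : Integrable (fun ω => B (f ω)) P)
    (hsec : ∀ x, Integrable (fun y => Φ (x, y)) ρ ∧ ∫ y, Φ (x, y) ∂ρ ≤ B x) :
    Integrable (fun ω => Φ (f ω, g ω)) P ∧ ∫ ω, Φ (f ω, g ω) ∂P ≤ ∫ ω, B (f ω) ∂P := by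
  have hfP : IsProbabilityMeasure (P.map f) := Measure.isProbabilityMeasure_map hf.aemeasurable
  have hmap : P.map (fun ω => (f ω, g ω)) = (P.map f).prod ρ := by
    rw [← hlaw]
    exact (indepFun_iff_map_prod_eq_prod_map_map hf.aemeasurable hg.aemeasurable).1 hind
  have hfg : AEMeasurable (fun ω => (f ω, g ω)) P := (hf.prodMk hg).aemeasurable
  have hBi : Integrable B (P.map f) :=
    (integrable_map_measure hB.aestronglyMeasurable hf.aemeasurable).2 hBint
  have hΦi : Integrable Φ ((P.map f).prod ρ) := by
    rw [integrable_prod_iff hΦ.aestronglyMeasurable]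
    refine ⟨Eventually.of_forall fun x => (hsec x).1, ?_⟩
    refine (hBi.add (integrable_const (2 * |c|))).mono'
      hΦ.norm.aestronglyMeasurable.integral_prod_right' (Eventually.of_forall fun x => ?_)
    rw [Real.norm_of_nonneg (integral_nonneg fun y => norm_nonneg _)]
    -- Since Φ ≥ c, |Φ| ≤ Φ + 2|c|; an upper bound on section integrals thus bounds absolute ones.
    have h1 := integral_mono (hsec x).1.norm ((hsec x).1.add (integrable_const (2 * |c|)))
      fun y => by
        simp only [Pi.add_apply, Real.norm_eq_abs]
        have h2 := hc (x, y)
        have h3 := neg_abs_le c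
        rcases abs_cases (Φ (x, y)) with h | h <;> linarith [abs_nonneg c]
    refine h1.trans ?_
    simp only [Pi.add_apply]
    rw [integral_add (hsec x).1 (integrable_const _)]
    simpa using (hsec x).2
  constructor
  · rw [← hmap] at hΦi
    exact (integrable_map_measure hΦ.aestronglyMeasurable hfg).1 hΦi
  · rw [← integral_map (φ := fun ω => (f ω, g ω)) hfg hΦ.aestronglyMeasurable, hmap,
      integral_prod _ hΦi, ← integral_map hf.aemeasurable hB.aestronglyMeasurable]
    exact integral_mono hΦi.integral_prod_left hBi fun x => (hsec x).2

/-- Telescoping of a perturbed descent recursion. -/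
theorem inf'_le_of_descent {T : ℕ} (hT : 0 < T) {γ a b : ℝ} (hγ : 0 < γ) (ha : 0 ≤ a)
    {δ r : ℕ → ℝ} (hδ : ∀ t, 0 ≤ δ t) (hrec : ∀ t, δ (t + 1) ≤ (1 + a) * δ t - γ / 2 * r t + b) :
    (Finset.range T).inf' (Finset.nonempty_range_iff.mpr hT.ne') r
      ≤ 2 * b / γ + 2 / (γ * T) * (1 + a) ^ T * δ 0 := by
  set R := (Finset.range T).inf' (Finset.nonempty_range_iff.mpr hT.ne') r
  have hT' : (0 : ℝ) < T := by exact_mod_cast hT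
  have hR : ∀ t < T, R ≤ r t := fun t ht => Finset.inf'_le _ (Finset.mem_range.2 ht)
  have h0 := hδ 0
  have hpos : 0 ≤ 2 / (γ * T) * (1 + a) ^ T * δ 0 := by positivity
  set s := γ / 2 * R - b with hs
  -- If s ≤ 0 the noise floor 2b/γ already bounds R. Otherwise every step loses at least s, and
  -- since a ≥ 0 the growth factor only amplifies accumulated losses.
  rcases le_or_gt s 0 with h | h
  · have : R ≤ 2 * b / γ := by
      rw [le_div_iff₀ hγ]
      linarith
    linarith
  · have hind : ∀ n ≤ T, δ n ≤ (1 + a) ^ n * δ 0 - n * s := by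
      intro n
      induction n with
      | zero => simp
      | succ n ih =>
        intro hn
        have h1 := ih (by omega)
        have h2 := hrec n
        have h3 := mul_le_mul_of_nonneg_left h1 (by linarith : 0 ≤ 1 + a)
        have h4 := mul_le_mul_of_nonneg_left (hR n (by omega)) (by linarith : 0 ≤ γ / 2)
        have h5 : 0 ≤ a * (n * s) := by positivity
        push_cast
        rw [pow_succ]
        nlinarith
    have h1 := (hδ T).trans (hind T le_rfl)
    have h2 : R = 2 * b / γ + 2 / (γ * T) * (T * s) := by
      rw [hs]
      field_simp
      ring
    rw [h2, mul_assoc (2 / (γ * T))]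
    have h3 : (T : ℝ) * s ≤ (1 + a) ^ T * δ 0 := by linarith
    have h4 := mul_le_mul_of_nonneg_left h3 (by positivity : 0 ≤ 2 / (γ * T))
    linarith

end BBVI

/-! ### The convergence bound -/

theorem mainTheorem9
    -- scale parameterization, dimension, number of Monte Carlo samples, number of iterations
    (fam : ScaleFamily) {d M T : ℕ} (hM : 0 < M) (hT : 0 < T)
    -- base distribution and diagonal conditioner
    (ν : Measure ℝ) (hν : IsBaseLaw ν)
    (φ : ℝ → ℝ) (Lφ : ℝ) (hLφ : 0 ≤ Lφ) (hφ : IsConditioner φ Lφ)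
    -- likelihood `z ↦ p(x | z)` and prior density
    (lik prior : EuclideanSpace ℝ (Fin d) → ℝ)
    (hlik : ∀ z, 0 < lik z) (hprior : ∀ z, 0 < prior z) (hprior_meas : Measurable prior)
    (hprior_one : ∫⁻ z, ENNReal.ofReal (prior z) = 1)
    -- smoothness of the joint negative log-likelihood and of the ELBO
    (Lℓ Ls : ℝ) (hLℓ : 0 < Lℓ) (hsmooth : IsSmooth Lℓ (negLogJoint lik prior))
    (hLs : 0 ≤ Ls) (hgrad : ReparamGradientBound fam ν φ (negLogJoint lik prior) Ls)
    -- quadratic growth of the likelihood, and the minimizers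
    (μ : ℝ) (hμ : 0 < μ) (hgrowth : QuadraticallyGrowing μ (negLogLik lik))
    (zlike zjoint : EuclideanSpace ℝ (Fin d))
    (hzlike : minimizers (negLogLik lik) = {zlike})
    (hzjoint : zjoint ∈ minimizers (negLogJoint lik prior))
    -- stepsize, with `L_F = Lℓ + Lφ + Ls`
    (γ : ℝ) (hγ : 0 < γ) (hγF : γ < 1 / (Lℓ + Lφ + Ls))
    -- initial point and i.i.d. samples from the base distribution
    (lam0 : Param fam d)
    {Ω : Type*} [MeasurableSpace Ω] (P : Measure Ω) [IsProbabilityMeasure P]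
    (u : ℕ → Fin M → Ω → Fin d → ℝ)
    (hu_meas : ∀ t m, Measurable (u t m))
    (hu_indep : iIndepFun (fun p : ℕ × Fin M => u p.1 p.2) P)
    (hu_law : ∀ t m, P.map (u t m) = base d ν) :
    let F : Param fam d → ℝ := negElbo ν φ (negLogJoint lik prior)
    let lam : ℕ → Ω → Param fam d := fun t ω =>
      sgd ν φ (negLogJoint lik prior) γ lam0 (fun t' m => u t' m ω) t
    let LF : ℝ := Lℓ + Lφ + Ls
    let κ : ℝ := Lℓ / μ
    let C : ℝ := dimConst fam d ν
    let Fstar : ℝ := ⨅ l, F l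
    let ellLikeStar : ℝ := ⨅ z, negLogLik lik z
    Differentiable ℝ F ∧
    BddBelow (Set.range F) ∧
    (∀ t, Integrable (fun ω => ‖gradient F (lam t ω)‖ ^ 2) P) ∧
    (Finset.range T).inf' (Finset.nonempty_range_iff.mpr hT.ne')
        (fun t => ∫ ω, ‖gradient F (lam t ω)‖ ^ 2 ∂P)
      ≤ γ * (2 * LF * Lℓ * κ * C / M) * (‖zjoint - zlike‖ ^ 2 + 2 * (Fstar - ellLikeStar))
        + 2 / (γ * T) * (1 + γ ^ 2 * (4 * LF * Lℓ * κ * C / M)) ^ T * (F lam0 - Fstar) := by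
  intro F lam LF κ C Fstar ellLikeStar
  have hM' : (0 : ℝ) < M := by exact_mod_cast hM
  have hLF : 0 < LF := by positivity
  have hκ : 0 < κ := div_pos hLℓ hμ
  have hC : 0 ≤ C := hν.dimConst_nonneg fam d
  have hlow := hν.add_norm_centered_sq_le_negElbo hφ hlik hprior hprior_meas hprior_one hsmooth hμ
    hgrowth hzlike (fam := fam)
  have hlow' : ∀ l, ellLikeStar ≤ F l := fun l =>
    (le_add_of_nonneg_right (by positivity)).trans (hlow l)
  have hbdd : BddBelow (Set.range F) := ⟨ellLikeStar, by rintro _ ⟨l, rfl⟩; exact hlow' l⟩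
  have hFs : ∀ l, Fstar ≤ F l := fun l => ciInf_le hbdd l
  have hFsl : ellLikeStar ≤ Fstar := le_ciInf hlow'
  have hgradF : gradient F = elboGrad ν φ (negLogJoint lik prior) :=
    gradient_eq fun l => hν.hasGradientAt_negElbo hLφ hφ hsmooth l
  set g : Param fam d → Param fam d := elboGrad ν φ (negLogJoint lik prior) with hg
  have hFc : Continuous F := hν.continuous_negElbo hLφ hφ hsmooth
  have hgc : Continuous g := hν.continuous_elboGrad hLℓ.le hφ hsmooth
  have hgF : ∀ l, ‖g l‖ ^ 2 ≤ 2 * LF * (F l - Fstar) := fun l =>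
    norm_sq_le_of_descent hLF (hν.negElbo_le_add hLℓ.le hLφ hLs hφ hsmooth hgrad l) hFs
  -- Writing F − ℓ_like* as (F − F*) + (F* − ℓ_like*) gives one share of the second gap and two of
  -- the first.
  have hvar : ∀ l, reparamVar ν (negLogJoint lik prior) (condMap φ l)
      ≤ 4 * Lℓ * κ * C * (Fstar - ellLikeStar) + 8 * Lℓ * κ * C * (F l - Fstar) := by
    intro l
    have h1 := hν.reparamVar_le hsmooth (condMap φ l)
    have h2 : Lℓ ^ 2 * ‖centered (condMap φ l)‖ ^ 2 ≤ 2 * Lℓ * κ * (F l - ellLikeStar) := by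
      have h3 : Lℓ ^ 2 * ‖centered (condMap φ l)‖ ^ 2
          = 2 * Lℓ * κ * (μ / 2 * ‖centered (condMap φ l)‖ ^ 2) := by
        simp only [κ]
        field_simp
      rw [h3]
      exact mul_le_mul_of_nonneg_left (by linarith [hlow l]) (by positivity)
    have h4 : ‖loc (meanGrad ν (negLogJoint lik prior) (condMap φ l))‖ ^ 2
        ≤ 2 * Lℓ * κ * (F l - Fstar) := by
      have hFl : 0 ≤ F l - Fstar := sub_nonneg.2 (hFs l)
      -- The bound κ ≥ 1 requires d > 0; for d = 0 the gradient vanishes.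
      rcases Nat.eq_zero_or_pos d with hd | hd
      · subst hd
        rw [Subsingleton.elim (loc _) 0, norm_zero, zero_pow two_ne_zero]
        positivity
      · refine (hν.norm_loc_meanGrad_sq_le hLℓ hφ hsmooth hFs l).trans ?_
        have h5 : 1 ≤ κ := (one_le_div hμ).2 (quadraticGrowth_le_smoothness hd hlik hprior
          hprior_meas hprior_one hsmooth hgrowth hzlike)
        have h6 : 0 ≤ 2 * Lℓ * (F l - Fstar) := by positivity
        nlinarith
    have h7 := mul_le_mul_of_nonneg_left (add_le_add h2 h4) (by positivity : 0 ≤ 2 * C)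
    linarith
  set a : ℝ := γ ^ 2 * (4 * LF * Lℓ * κ * C / M) with ha
  set b : ℝ := γ ^ 2 * LF / (2 * M) * (4 * Lℓ * κ * C * (Fstar - ellLikeStar)) with hb
  have ha0 : 0 ≤ a := by positivity
  -- The conditional bound on F after one step, given the current iterate.
  set B : Param fam d → ℝ := fun l => (1 + a) * (F l - Fstar) - γ / 2 * ‖g l‖ ^ 2 + b + Fstar with hB
  have hlam : ∀ t, Measurable (lam t) := fun t => hν.measurable_sgd hLφ hφ hsmooth hu_meas t
  have hgint : ∀ t, Integrable (fun ω => F (lam t ω)) P →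
      Integrable (fun ω => ‖g (lam t ω)‖ ^ 2) P := by
    intro t ht
    refine ((ht.sub (integrable_const Fstar)).const_mul (2 * LF)).mono'
      ((hgc.norm.pow 2).measurable.comp (hlam t)).aestronglyMeasurable
      (Filter.Eventually.of_forall fun ω => ?_)
    rw [Real.norm_of_nonneg (by positivity)]
    exact hgF _
  have hBint : ∀ t, Integrable (fun ω => F (lam t ω)) P →
      HasMean P (fun ω => B (lam t ω)) ((1 + a) * ((∫ ω, F (lam t ω) ∂P) - Fstar)
        - γ / 2 * (∫ ω, ‖g (lam t ω)‖ ^ 2 ∂P) + b + Fstar) := fun t ht =>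
    ((((ht.hasMean.sub (HasMean.const Fstar)).const_mul (1 + a)).sub
      ((hgint t ht).hasMean.const_mul (γ / 2))).add (HasMean.const b)).add (HasMean.const Fstar)
  have hstep : ∀ t, Integrable (fun ω => F (lam t ω)) P →
      Integrable (fun ω => F (lam (t + 1) ω)) P ∧
        ∫ ω, F (lam (t + 1) ω) ∂P ≤ ∫ ω, B (lam t ω) ∂P := by
    intro t ht
    have hprob := hν.isProb_base d
    have h := (hν.indepFun_sgd (γ := γ) (lam0 := lam0) hLφ hφ hsmooth hu_meas hu_indep
      t).integral_le_of_integral_le (hlam t) (measurable_pi_lambda _ fun m => hu_meas t m)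
      (map_samples_eq_pi hu_meas hu_indep hu_law t)
      (Φ := fun q => F (sgdStep φ (negLogJoint lik prior) γ q.1 q.2))
      (hFc.measurable.comp (continuous_sgdStep hφ hsmooth γ).measurable) (c := Fstar)
      (fun q => hFs _) (B := B) (by fun_prop) (hBint t ht).1 fun l => by
        have h1 := hν.integral_negElbo_sgdStep_le hM hLℓ hLφ hLs hφ hsmooth hgrad hFs hγ hγF l
        refine ⟨h1.1, h1.2.trans ?_⟩
        have h2 := mul_le_mul_of_nonneg_left (hvar l)
          (by positivity : 0 ≤ γ ^ 2 * LF / (2 * M))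
        have h3 : γ ^ 2 * LF / (2 * M) * (8 * Lℓ * κ * C * (F l - Fstar))
            = a * (F l - Fstar) := by
          rw [ha]
          field_simp
          ring
        simp only [hB, hb]
        rw [mul_add (γ ^ 2 * LF / (2 * M)), h3] at h2
        change F l - γ / 2 * ‖g l‖ ^ 2
          + γ ^ 2 * LF / (2 * M) * reparamVar ν (negLogJoint lik prior) (condMap φ l) ≤ _
        linarith
    simp only [lam, hν.sgd_succ hLφ hφ hsmooth]
    exact h
  -- Integrability propagates along the iteration together with the descent bound; that of ‖∇F‖²
  -- follows from ‖∇F‖² ≤ 2 L_F (F − F*).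
  have hint : ∀ t, Integrable (fun ω => F (lam t ω)) P := by
    intro t
    induction t with
    | zero => exact integrable_const (F lam0)
    | succ t ih => exact (hstep t ih).1
  rw [hgradF]
  refine ⟨fun l => (hν.hasGradientAt_negElbo hLφ hφ hsmooth l).differentiableAt, hbdd,
    fun t => hgint t (hint t), ?_⟩
  have hfin := inf'_le_of_descent hT hγ ha0 (b := b)
    (δ := fun t => (∫ ω, F (lam t ω) ∂P) - Fstar) (r := fun t => ∫ ω, ‖g (lam t ω)‖ ^ 2 ∂P)
    (fun t => sub_nonneg.2 ((HasMean.const Fstar).le (hint t).hasMean fun ω => hFs _)) fun t => by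
      have h1 := (hstep t (hint t)).2
      rw [(hBint t (hint t)).2] at h1
      linarith
  have h0 : ∫ ω, F (lam 0 ω) ∂P = F lam0 := by
    simp [lam, sgd]
  rw [h0] at hfin
  refine hfin.trans ?_
  have h1 : 2 * b / γ = γ * (2 * LF * Lℓ * κ * C / M) * (2 * (Fstar - ellLikeStar)) := by
    rw [hb]
    field_simp
    ring
  rw [h1]
  gcongr
  exact le_add_of_nonneg_left (sq_nonneg _)
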